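/- Write $H=-\Delta+|x|^2$ on $\mathbb{R}^3$. For $d\in L^2(\mathbb{R}^3)$ (complex-valued), let $u(t)=e^{-itH}d$ denote the solution of $$ i\,\partial_t u=-\Delta u+|x|^2u,\qquad u(0)=d, $$ that is, the unique $u\in C(\mathbb{R};L^2(\mathbb{R}^3))$ with $u(0)=d$ such that for every Schwartz function $\varphi$ on $\mathbb{R}^3$ and every $t\in\mathbb{R}$, $\frac{d}{dt}\int_{\mathbb{R}^3}\varphi\,u(t)\,dx=-i\int_{\mathbb{R}^3}(-\Delta\varphi+|x|^2\varphi)\,u(t)\,dx$. There is an absolute constant $C>0$ such that, for every $d\in L^2(\mathbb{R}^3)$ that is even in each coordinate separately, i.e. $d(\pm x_1,\pm x_2,\pm x_3)=d(x_1,x_2,x_3)$ for almost every $x$ and every choice of signs, this solution exists and is unique, and $$ \int_0^{2\pi}\int_{\mathbb{R}^3}\frac{\left|e^{-it(-\Delta+|x|^2)}d\,(x)\right|^2}{|x|^2}\,dx\,dt\le C\,\|d\|_{L^2(\mathbb{R}^3)}^2 . $$ -/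

import Mathlib

open MeasureTheory Filter Topology
open scoped Laplacian SchwartzMap ENNReal

namespace HarmonicOscillator

/-- The complex Hilbert space `L²(ℝⁿ)`, for Lebesgue measure on Euclidean space. -/
abbrev L2 (n : ℕ) : Type :=
  Lp ℂ 2 (volume : Measure (EuclideanSpace ℝ (Fin n)))

/-- The Hermite operator `-Δ + |x|²`, applied to a (twice differentiable) function. -/
noncomputable def hermiteOp {n : ℕ} (φ : EuclideanSpace ℝ (Fin n) → ℂ) :
    EuclideanSpace ℝ (Fin n) → ℂ :=
  fun x => -(Δ φ) x + ((‖x‖ ^ 2 : ℝ) : ℂ) * φ x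

/-- `u` is the solution of `i ∂ₜ u = (-Δ + |x|²) u` with initial datum `u(0) = d ∈ L²(ℝⁿ)`,
i.e. `u(t) = e^{-it(-Δ + |x|²)} d`: a continuous curve in `L²(ℝⁿ)` that satisfies the equation
weakly in the space variable, tested against Schwartz functions. -/
structure IsSolution {n : ℕ} (d : L2 n) (u : ℝ → L2 n) : Prop where
  continuous : Continuous u
  initial : u 0 = d
  equation : ∀ (φ : 𝓢(EuclideanSpace ℝ (Fin n), ℂ)) (t : ℝ),
    HasDerivAt (fun s : ℝ => ∫ x, φ x * u s x)
      (-Complex.I * ∫ x, hermiteOp φ x * u t x) t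

/-- `d(x₁, …, -xᵢ, …, xₙ) = d(x₁, …, xᵢ, …, xₙ)` for almost every `x`, for every `i`. -/
def IsEvenInEachCoordinate {n : ℕ} (d : L2 n) : Prop :=
  ∀ i : Fin n, ∀ᵐ x : EuclideanSpace ℝ (Fin n),
    d (WithLp.toLp 2 (Function.update x.ofLp i (-(x i)))) = d x

end HarmonicOscillator

/-!
Let `H = -Δ + |x|²` on `ℝⁿ`, with creation and annihilation operators `xᵢ ∓ ∂ᵢ`. Applying `N`
creation operators to the Gaussian gives a finite-dimensional space `eigenspace n N` on which
`H = 2N + n`. These spaces are orthogonal and complete in `L²`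
(`isHilbertSum_eigenspaceL2`), so `e^{-itH} d = ∑ e^{-it(2N+n)} P_N d`. This series is a solution
(`isSolution_evolution`), and testing the equation against eigenfunctions shows that it is the only
one (`IsSolution.unique`).

Since the energies differ by integers, Parseval in time over `[0, 2π]` turns the space-time
integral into `2π ∑ ‖|x|⁻¹ P_N d‖²`. It remains to bound `‖|x|⁻¹ f‖² ≤ 2 ‖f‖²` for an
eigenfunction `f` on `ℝ³`, uniformly in `N` (`norm_sq_invNormMul_le`). Behind this is the
`sl₂`-symmetry of the problem: `∫ ‖|x|⁻¹ e^{-itH} f‖² dt` is invariant under the metaplectic action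
of `SL₂(ℝ)`, hence on each angular momentum `ℓ` a multiple of `‖f‖²`, and the multiple can be read
off from the lowest state.

Concretely, let `L₋ = ∑ aᵢ²` and `L₊ = ∑ (aᵢ†)²` and let `Q(f, g) = ⟨f, |x|⁻² g⟩`. Because `|x|⁻²`
is homogeneous of degree `-2` (`integral_inv_norm_sq_mul_eulerField`) and `L₊` raises the energy by
`4`, one has `Q(L₋ f, g) = Q(f, L₊ g)` for `f` of degree `N + 2` and `g` of degree `N`
(`inner_invNormMul_lowering_eq_raising`). Thus if `f` is an eigenvector of `Q` relative to the `L²`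
inner product, on the eigenspace of degree `N`, then `L₋ f` is either zero or an eigenvector of `Q`
in degree `N - 2` with the same eigenvalue. In the first case the homogeneity identity gives
`(2N + 1) Q(f, f) = 2 ‖f‖²`, so by induction all eigenvalues of `Q` are at most `2`.

The bound is transferred from finite sums of eigenfunctions to all of `L²` by truncating the weight
`|x|⁻¹`, which makes it a bounded operator, and applying Fatou's lemma and monotone convergence.
-/

namespace HarmonicOscillator

/-! ### Ladder operators on Schwartz space -/

section Ladder

variable {n : ℕ}

/-- Multiplication by the `i`-th coordinate, as an operator on Schwartz functions. -/
noncomputable def coordMul (i : Fin n) :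
    𝓢(EuclideanSpace ℝ (Fin n), ℂ) →L[ℂ] 𝓢(EuclideanSpace ℝ (Fin n), ℂ) :=
  SchwartzMap.smulLeftCLM ℂ (fun x : EuclideanSpace ℝ (Fin n) => (x i : ℂ))

/-- The `i`-th partial derivative, as an operator on Schwartz functions. -/
noncomputable def partialDeriv (i : Fin n) :
    𝓢(EuclideanSpace ℝ (Fin n), ℂ) →L[ℂ] 𝓢(EuclideanSpace ℝ (Fin n), ℂ) :=
  LineDeriv.lineDerivOpCLM ℂ 𝓢(EuclideanSpace ℝ (Fin n), ℂ) (EuclideanSpace.single i (1 : ℝ))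

/-- The creation operator `xᵢ - ∂ᵢ`. -/
noncomputable def creation (i : Fin n) :
    𝓢(EuclideanSpace ℝ (Fin n), ℂ) →L[ℂ] 𝓢(EuclideanSpace ℝ (Fin n), ℂ) :=
  coordMul i - partialDeriv i

/-- The annihilation operator `xᵢ + ∂ᵢ`. -/
noncomputable def annihilation (i : Fin n) :
    𝓢(EuclideanSpace ℝ (Fin n), ℂ) →L[ℂ] 𝓢(EuclideanSpace ℝ (Fin n), ℂ) :=
  coordMul i + partialDeriv i

/-- The operator `-Δ + |x|²` on Schwartz functions, in the form `∑ᵢ (xᵢ² - ∂ᵢ²)`. -/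
noncomputable def hermiteCLM :
    𝓢(EuclideanSpace ℝ (Fin n), ℂ) →L[ℂ] 𝓢(EuclideanSpace ℝ (Fin n), ℂ) :=
  ∑ i, (coordMul i * coordMul i - partialDeriv i * partialDeriv i)

lemma hasTemperateGrowth_coord (i : Fin n) :
    Function.HasTemperateGrowth (fun x : EuclideanSpace ℝ (Fin n) => (x i : ℂ)) :=
  (Complex.ofRealCLM ∘L
    (EuclideanSpace.proj i : EuclideanSpace ℝ (Fin n) →L[ℝ] ℝ)).hasTemperateGrowth

@[simp]
lemma coordMul_apply (i : Fin n) (f : 𝓢(EuclideanSpace ℝ (Fin n), ℂ))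
    (x : EuclideanSpace ℝ (Fin n)) : coordMul i f x = x i * f x := by
  simp [coordMul, SchwartzMap.smulLeftCLM_apply_apply (hasTemperateGrowth_coord i)]

lemma partialDeriv_apply (i : Fin n) (f : 𝓢(EuclideanSpace ℝ (Fin n), ℂ))
    (x : EuclideanSpace ℝ (Fin n)) :
    partialDeriv i f x = fderiv ℝ f x (EuclideanSpace.single i 1) := rfl

lemma coordMul_comm (i j : Fin n) :
    coordMul i * coordMul j = coordMul j * coordMul i := by
  ext f x
  simp only [mul_apply_eq_comp, coordMul_apply]
  ring

lemma partialDeriv_comm (i j : Fin n) :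
    partialDeriv i * partialDeriv j = partialDeriv j * partialDeriv i := by
  ext f x
  have key : ∀ a b : Fin n, partialDeriv a (partialDeriv b f) x
      = fderiv ℝ (fderiv ℝ f) x (EuclideanSpace.single a 1) (EuclideanSpace.single b 1) := by
    intro a b
    rw [partialDeriv_apply]
    have h : DifferentiableAt ℝ (fderiv ℝ f) x :=
      ((f.smooth 2).fderiv_right (m := 1) (by norm_num)).differentiable (by norm_num) x
    have := (h.hasFDerivAt.clm_apply
      (hasFDerivAt_const (EuclideanSpace.single b (1 : ℝ)) x)).fderiv
    change fderiv ℝ (fun y => fderiv ℝ f y (EuclideanSpace.single b 1)) x _ = _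
    rw [this]
    simp
  simp only [mul_apply_eq_comp, key]
  have hs : IsSymmSndFDerivAt ℝ f x :=
    (f.smooth 2).contDiffAt.isSymmSndFDerivAt (by simp)
  exact hs _ _

/-- The canonical commutation relation `[∂ᵢ, xⱼ] = δᵢⱼ`. -/
lemma partialDeriv_mul_coordMul (i j : Fin n) :
    partialDeriv i * coordMul j = coordMul j * partialDeriv i + if i = j then 1 else 0 := by
  ext f x
  have h1 : HasFDerivAt (fun y : EuclideanSpace ℝ (Fin n) => (y j : ℂ))
      (Complex.ofRealCLM ∘L (EuclideanSpace.proj j : EuclideanSpace ℝ (Fin n) →L[ℝ] ℝ)) x :=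
    (Complex.ofRealCLM ∘L
      (EuclideanSpace.proj j : EuclideanSpace ℝ (Fin n) →L[ℝ] ℝ)).hasFDerivAt
  have h2 := (h1.mul (f.hasFDerivAt x)).fderiv
  have h3 : (coordMul j f : EuclideanSpace ℝ (Fin n) → ℂ) = fun y => (y j : ℂ) * f y := by
    ext y; simp
  simp only [mul_apply_eq_comp, add_apply,
    partialDeriv_apply, coordMul_apply, h3]
  erw [h2]
  by_cases hij : i = j
  · subst hij
    simp
  · simp [hij, Ne.symm hij]

lemma hermiteCLM_apply (f : 𝓢(EuclideanSpace ℝ (Fin n), ℂ)) :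
    (hermiteCLM f : EuclideanSpace ℝ (Fin n) → ℂ) = hermiteOp f := by
  ext x
  have h1 : (Δ f : 𝓢(EuclideanSpace ℝ (Fin n), ℂ)) x
      = ∑ i, partialDeriv i (partialDeriv i f) x := by
    rw [SchwartzMap.laplacian_eq_sum (EuclideanSpace.basisFun (Fin n) ℝ)]
    simp [partialDeriv]
  rw [hermiteOp, ← SchwartzMap.laplacian_apply, h1, EuclideanSpace.norm_sq_eq]
  simp only [hermiteCLM, sum_apply,
    sub_apply, mul_apply_eq_comp,
    coordMul_apply, Finset.sum_sub_distrib, Real.norm_eq_abs, sq_abs]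
  push_cast
  rw [Finset.sum_mul, sub_eq_neg_add]
  congr 1
  exact Finset.sum_congr rfl fun i _ => by ring

/-- `[aⱼ, aᵢ†] = 2 δᵢⱼ`. -/
lemma annihilation_mul_creation (i j : Fin n) :
    annihilation j * creation i = creation i * annihilation j + if i = j then 2 else 0 := by
  have h1 := partialDeriv_mul_coordMul i j
  have h2 := partialDeriv_mul_coordMul j i
  have h3 := coordMul_comm i j
  have h4 := partialDeriv_comm i j
  simp only [annihilation, creation, mul_add, add_mul, mul_sub, sub_mul, h1, h2, h3, h4]
  by_cases hij : i = j
  · subst hij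
    simp only [if_true]
    rw [show (2 : 𝓢(EuclideanSpace ℝ (Fin n), ℂ) →L[ℂ] 𝓢(EuclideanSpace ℝ (Fin n), ℂ)) = 1 + 1 from
      one_add_one_eq_two.symm]
    abel
  · simp only [hij, Ne.symm hij, if_false]
    abel

/-- `[H, aⱼ†] = 2 aⱼ†`: creation operators raise the energy by two. -/
lemma hermiteCLM_mul_creation (j : Fin n) :
    hermiteCLM * creation j = creation j * hermiteCLM + 2 * creation j := by
  have key : ∀ i : Fin n,
      (coordMul i * coordMul i - partialDeriv i * partialDeriv i) * creation j
        = creation j * (coordMul i * coordMul i - partialDeriv i * partialDeriv i)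
          + if i = j then 2 * creation j else 0 := by
    intro i
    have h1 := partialDeriv_mul_coordMul i j
    have h2 := partialDeriv_mul_coordMul j i
    have h3 := coordMul_comm i j
    have h4 := partialDeriv_comm i j
    have e1 : partialDeriv i * partialDeriv i * coordMul j
        = coordMul j * (partialDeriv i * partialDeriv i)
        + (if i = j then 2 * partialDeriv i else 0) := by
      rw [mul_assoc, h1, mul_add, ← mul_assoc, h1, add_mul]
      by_cases hij : i = j
      · simp [hij, two_mul, mul_assoc, add_assoc]
      · simp [hij, mul_assoc]
    have e2 : partialDeriv j * (coordMul i * coordMul i) = coordMul i * coordMul i * partialDeriv j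
        + (if i = j then 2 * coordMul i else 0) := by
      rw [← mul_assoc, h2, add_mul, mul_assoc, h2, mul_add]
      by_cases hij : i = j
      · simp [hij, two_mul, mul_assoc, add_assoc]
      · simp [hij, Ne.symm hij, mul_assoc]
    have e3 : coordMul i * coordMul i * coordMul j = coordMul j * (coordMul i * coordMul i) := by
      rw [mul_assoc, h3, ← mul_assoc, h3, mul_assoc]
    have e4 : partialDeriv i * partialDeriv i * partialDeriv j
        = partialDeriv j * (partialDeriv i * partialDeriv i) := by
      rw [mul_assoc, h4, ← mul_assoc, h4, mul_assoc]
    simp only [creation, mul_sub, sub_mul, e1, e2, e3, e4]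
    by_cases hij : i = j
    · subst hij
      simp only [if_true]
      abel
    · simp only [hij, if_false]
      abel
  rw [hermiteCLM, Finset.sum_mul, Finset.mul_sum]
  simp only [key, Finset.sum_add_distrib, Finset.sum_ite_eq', Finset.mem_univ, if_true]

/-- Integration by parts: `aᵢ†` is the transpose of `aᵢ`. -/
lemma integral_creation_mul (i : Fin n) (f g : 𝓢(EuclideanSpace ℝ (Fin n), ℂ)) :
    ∫ x, creation i f x * g x = ∫ x, f x * annihilation i g x := by
  have h := SchwartzMap.integral_mul_lineDerivOp_right_eq_neg_left (μ := volume) f g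
    (EuclideanSpace.single i (1 : ℝ))
  have i1 : Integrable (fun x => partialDeriv i f x * g x) :=
    (SchwartzMap.pairing (ContinuousLinearMap.mul ℂ ℂ) (partialDeriv i f) g).integrable
  have i2 : Integrable (fun x => f x * partialDeriv i g x) :=
    (SchwartzMap.pairing (ContinuousLinearMap.mul ℂ ℂ) f (partialDeriv i g)).integrable
  have i3 : Integrable (fun x => f x * coordMul i g x) :=
    (SchwartzMap.pairing (ContinuousLinearMap.mul ℂ ℂ) f (coordMul i g)).integrable
  have e1 : ∀ x, creation i f x * g x = f x * coordMul i g x - partialDeriv i f x * g x := by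
    intro x
    simp [creation]; ring
  have e2 : ∀ x, f x * annihilation i g x = f x * coordMul i g x + f x * partialDeriv i g x := by
    intro x
    simp [annihilation]; ring
  simp_rw [e1, e2]
  rw [integral_sub i3 i1, integral_add i3 i2]
  have h' : ∫ x, f x * partialDeriv i g x = -∫ x, partialDeriv i f x * g x := h
  rw [h']
  ring

/-- Symmetry of `-Δ + |x|²` for the bilinear pairing. -/
lemma integral_hermiteCLM_mul (f g : 𝓢(EuclideanSpace ℝ (Fin n), ℂ)) :
    ∫ x, hermiteCLM f x * g x = ∫ x, f x * hermiteCLM g x := by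
  have h := SchwartzMap.integral_mul_laplacian_right_eq_left (μ := volume) f g
  have i1 : Integrable (fun x => (Δ f : 𝓢(EuclideanSpace ℝ (Fin n), ℂ)) x * g x) :=
    (SchwartzMap.pairing (ContinuousLinearMap.mul ℂ ℂ) (Δ f) g).integrable
  have i2 : Integrable (fun x => f x * (Δ g : 𝓢(EuclideanSpace ℝ (Fin n), ℂ)) x) :=
    (SchwartzMap.pairing (ContinuousLinearMap.mul ℂ ℂ) f (Δ g)).integrable
  have i3 : Integrable (fun x : EuclideanSpace ℝ (Fin n) => f x * (((‖x‖ ^ 2 : ℝ) : ℂ) * g x)) := by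
    have h0 : Integrable (fun x => f x * hermiteCLM g x
        + f x * (Δ g : 𝓢(EuclideanSpace ℝ (Fin n), ℂ)) x) :=
      ((SchwartzMap.pairing (ContinuousLinearMap.mul ℂ ℂ) f (hermiteCLM g)).integrable).add i2
    refine h0.congr (Eventually.of_forall fun x => ?_)
    simp only [hermiteCLM_apply, hermiteOp, ← SchwartzMap.laplacian_apply]
    ring
  have e1 : ∀ x, hermiteCLM f x * g x = f x * (((‖x‖ ^ 2 : ℝ) : ℂ) * g x)
      - (Δ f : 𝓢(EuclideanSpace ℝ (Fin n), ℂ)) x * g x := by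
    intro x
    simp only [hermiteCLM_apply, hermiteOp, ← SchwartzMap.laplacian_apply]; ring
  have e2 : ∀ x, f x * hermiteCLM g x = f x * (((‖x‖ ^ 2 : ℝ) : ℂ) * g x)
      - f x * (Δ g : 𝓢(EuclideanSpace ℝ (Fin n), ℂ)) x := by
    intro x
    simp only [hermiteCLM_apply, hermiteOp, ← SchwartzMap.laplacian_apply]; ring
  simp_rw [e1, e2]
  rw [integral_sub i3 i1, integral_sub i3 i2, h]

end Ladder

/-! ### The Gaussian as a Schwartz function -/

section Gaussian

lemma pow_mul_polynomial_mul_gaussian_bounded (k : ℕ) (p : Polynomial ℤ) :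
    ∃ C : ℝ, ∀ x : ℝ, |x| ^ k * |Polynomial.aeval x p * Real.exp (-(x ^ 2 / 2))| ≤ C := by
  have mono : ∀ m : ℕ, ∃ C : ℝ, ∀ x : ℝ, |x| ^ m * Real.exp (-(x ^ 2 / 2)) ≤ C := by
    intro m
    refine ⟨1 + 2 ^ m * m.factorial, fun x => ?_⟩
    have h1 : (x ^ 2 / 2) ^ m / m.factorial ≤ Real.exp (x ^ 2 / 2) :=
      Real.pow_div_factorial_le_exp _ (by positivity) m
    have h2 : |x| ^ m ≤ 1 + |x| ^ (2 * m) := by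
      rcases le_total (|x|) 1 with h | h
      · have := pow_le_one₀ (abs_nonneg x) h (n := m)
        have : 0 ≤ |x| ^ (2 * m) := by positivity
        linarith
      · have := pow_le_pow_right₀ h (show m ≤ 2 * m by omega)
        linarith
    have h3 : |x| ^ (2 * m) = 2 ^ m * (x ^ 2 / 2) ^ m := by
      rw [pow_mul, sq_abs, ← mul_pow]; congr 1; ring
    have h4 : Real.exp (-(x ^ 2 / 2)) ≤ 1 := by
      have := sq_nonneg x
      exact Real.exp_le_one_iff.2 (by linarith)
    have h5 : (x ^ 2 / 2) ^ m * Real.exp (-(x ^ 2 / 2)) ≤ m.factorial := by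
      rw [Real.exp_neg, ← div_eq_mul_inv, div_le_iff₀ (Real.exp_pos _)]
      rw [div_le_iff₀ (by positivity)] at h1
      linarith
    calc |x| ^ m * Real.exp (-(x ^ 2 / 2))
        ≤ (1 + |x| ^ (2 * m)) * Real.exp (-(x ^ 2 / 2)) := by gcongr
      _ = Real.exp (-(x ^ 2 / 2)) + 2 ^ m * ((x ^ 2 / 2) ^ m * Real.exp (-(x ^ 2 / 2))) := by
          rw [h3]; ring
      _ ≤ 1 + 2 ^ m * m.factorial := by gcongr
  induction p using Polynomial.induction_on' with
  | add p q hp hq =>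
    obtain ⟨C, hC⟩ := hp
    obtain ⟨C', hC'⟩ := hq
    refine ⟨C + C', fun x => ?_⟩
    rw [map_add, add_mul]
    calc _ ≤ |x| ^ k * (|Polynomial.aeval x p * Real.exp (-(x ^ 2 / 2))|
          + |Polynomial.aeval x q * Real.exp (-(x ^ 2 / 2))|) := by
          gcongr; exact abs_add_le _ _
      _ ≤ C + C' := by rw [mul_add]; exact add_le_add (hC x) (hC' x)
  | monomial m a =>
    obtain ⟨C, hC⟩ := mono (k + m)
    refine ⟨|(a : ℝ)| * C, fun x => ?_⟩
    rw [Polynomial.aeval_monomial, abs_mul, abs_mul, abs_pow, Real.abs_exp]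
    simp only [algebraMap_int_eq, eq_intCast]
    calc |x| ^ k * (|(a : ℝ)| * |x| ^ m * Real.exp (-(x ^ 2 / 2)))
        = |(a : ℝ)| * (|x| ^ (k + m) * Real.exp (-(x ^ 2 / 2))) := by ring
      _ ≤ _ := by gcongr; exact hC x

/-- The one-dimensional Gaussian `exp (-y² / 2)` as a Schwartz function. -/
noncomputable def realGaussian : 𝓢(ℝ, ℝ) where
  toFun y := Real.exp (-(y ^ 2 / 2))
  smooth' := by fun_prop
  decay' k m := by
    obtain ⟨C, hC⟩ := pow_mul_polynomial_mul_gaussian_bounded k (Polynomial.hermite m)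
    refine ⟨C, fun x => ?_⟩
    rw [norm_iteratedFDeriv_eq_norm_iteratedDeriv, iteratedDeriv_eq_iterate,
      Polynomial.deriv_gaussian_eq_hermite_mul_gaussian, mul_assoc, norm_mul, norm_pow, norm_neg,
      norm_one, one_pow, one_mul]
    exact hC x

variable {n : ℕ}

lemma hasTemperateGrowth_japaneseBracket :
    Function.HasTemperateGrowth
      (fun x : EuclideanSpace ℝ (Fin n) => (1 + ‖x‖ ^ 2) ^ (1 / 2 : ℝ)) := by
  fun_prop

/-- The Gaussian `exp (-|x|² / 2)` on `ℝⁿ`. It is a Schwartz function because it is, up to a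
constant, the one-dimensional Gaussian composed with the smooth function `√(1 + |x|²)`. -/
noncomputable def gaussian : 𝓢(EuclideanSpace ℝ (Fin n), ℂ) :=
  Complex.exp (1 / 2) • SchwartzMap.postcompCLM Complex.ofRealCLM
    (SchwartzMap.compCLM ℝ (hasTemperateGrowth_japaneseBracket (n := n))
      ⟨1, 1, fun x => by
        rw [← Real.sqrt_eq_rpow, Real.norm_of_nonneg (Real.sqrt_nonneg _), one_mul, pow_one]
        have : ‖x‖ ≤ √(1 + ‖x‖ ^ 2) := Real.le_sqrt_of_sq_le (by linarith)
        linarith⟩ realGaussian)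

lemma gaussian_apply (x : EuclideanSpace ℝ (Fin n)) :
    gaussian x = ((Real.exp (-(‖x‖ ^ 2 / 2)) : ℝ) : ℂ) := by
  have h : realGaussian (√(1 + ‖x‖ ^ 2)) = Real.exp (-((1 + ‖x‖ ^ 2) / 2)) := by
    change Real.exp (-(√(1 + ‖x‖ ^ 2) ^ 2 / 2)) = _
    rw [Real.sq_sqrt (by positivity)]
  simp only [gaussian, smul_apply, SchwartzMap.postcompCLM_apply, SchwartzMap.compCLM_apply,
    Function.comp_apply, ← Real.sqrt_eq_rpow, h, Complex.ofRealCLM_apply, smul_eq_mul]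
  rw [show (1 / 2 : ℂ) = ((1 / 2 : ℝ) : ℂ) by norm_num, ← Complex.ofReal_exp, ← Complex.ofReal_mul,
    ← Real.exp_add]
  congr 2
  ring

lemma annihilation_gaussian (i : Fin n) : annihilation i (gaussian (n := n)) = 0 := by
  ext x
  have h0 : HasFDerivAt (fun y : EuclideanSpace ℝ (Fin n) => -(‖y‖ ^ 2 / 2))
      (-(innerSL ℝ x)) x := by
    have := ((hasStrictFDerivAt_norm_sq x).hasFDerivAt.mul_const (1 / 2 : ℝ)).neg
    refine (this.congr_fderiv ?_).congr_of_eventuallyEq (Eventually.of_forall fun y => ?_)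
    · ext v; simp
    · simp [div_eq_mul_inv]
  have h1 := (Complex.ofRealCLM.hasFDerivAt.comp x h0.exp).fderiv
  have h2 : (gaussian : EuclideanSpace ℝ (Fin n) → ℂ)
      = Complex.ofRealCLM ∘ fun y => Real.exp (-(‖y‖ ^ 2 / 2)) := by
    ext y; rw [gaussian_apply]; rfl
  simp only [annihilation, add_apply, coordMul_apply, partialDeriv_apply]
  rw [h2, h1]
  simp [EuclideanSpace.inner_single_right, mul_comm]

end Gaussian

/-! ### The eigenspaces of the harmonic oscillator -/

section Eigenspaces

variable {n : ℕ}

/-- The span of the Hermite functions of degree `N`: apply `N` creation operators to the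
Gaussian. This is the eigenspace of `-Δ + |x|²` for the eigenvalue `2N + n`. -/
noncomputable def eigenspace (n : ℕ) : ℕ → Submodule ℂ 𝓢(EuclideanSpace ℝ (Fin n), ℂ)
  | 0 => ℂ ∙ gaussian
  | N + 1 => ⨆ i, (eigenspace n N).map (creation i : _ →L[ℂ] _).toLinearMap

lemma creation_mem_eigenspace {N : ℕ} {f : 𝓢(EuclideanSpace ℝ (Fin n), ℂ)}
    (hf : f ∈ eigenspace n N) (i : Fin n) : creation i f ∈ eigenspace n (N + 1) :=
  Submodule.mem_iSup_of_mem i (Submodule.mem_map_of_mem hf)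

lemma eigenspace_succ_induction {N : ℕ} {p : 𝓢(EuclideanSpace ℝ (Fin n), ℂ) → Prop}
    (hc : ∀ i, ∀ f ∈ eigenspace n N, p (creation i f)) (h0 : p 0)
    (ha : ∀ f g, p f → p g → p (f + g)) {f : 𝓢(EuclideanSpace ℝ (Fin n), ℂ)}
    (hf : f ∈ eigenspace n (N + 1)) : p f := by
  refine Submodule.iSup_induction _ (motive := p) hf ?_ h0 ha
  rintro i _ ⟨g, hg, rfl⟩
  exact hc i g hg

instance finiteDimensional_eigenspace (N : ℕ) : FiniteDimensional ℂ (eigenspace n N) := by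
  induction N with
  | zero => exact inferInstanceAs (FiniteDimensional ℂ (ℂ ∙ gaussian))
  | succ N ih =>
    exact inferInstanceAs (FiniteDimensional ℂ
      ↥(⨆ i, (eigenspace n N).map (creation i : _ →L[ℂ] _).toLinearMap))

lemma annihilation_creation (i j : Fin n) (f : 𝓢(EuclideanSpace ℝ (Fin n), ℂ)) :
    annihilation j (creation i f)
      = creation i (annihilation j f) + if i = j then (2 : ℂ) • f else 0 := by
  have := DFunLike.congr_fun (annihilation_mul_creation i j) f
  simp only [mul_apply_eq_comp, add_apply] at this
  rw [this]
  split_ifs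
  · congr 1
    rw [two_smul, show (2 : 𝓢(EuclideanSpace ℝ (Fin n), ℂ) →L[ℂ] 𝓢(EuclideanSpace ℝ (Fin n), ℂ))
      = 1 + 1 from one_add_one_eq_two.symm]
    rfl
  · rfl

lemma annihilation_eq_zero_of_mem {f : 𝓢(EuclideanSpace ℝ (Fin n), ℂ)}
    (hf : f ∈ eigenspace n 0) (j : Fin n) : annihilation j f = 0 := by
  obtain ⟨c, rfl⟩ := Submodule.mem_span_singleton.1 hf
  rw [map_smul, annihilation_gaussian, smul_zero]

lemma annihilation_mem_eigenspace {N : ℕ} {f : 𝓢(EuclideanSpace ℝ (Fin n), ℂ)}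
    (hf : f ∈ eigenspace n (N + 1)) (j : Fin n) : annihilation j f ∈ eigenspace n N := by
  induction N generalizing f with
  | zero =>
    refine eigenspace_succ_induction (p := fun f => annihilation j f ∈ eigenspace n 0)
      (fun i g hg => ?_) (by simp) (fun f g hf hg => ?_) hf
    · rw [annihilation_creation, annihilation_eq_zero_of_mem hg, map_zero, zero_add]
      split_ifs
      · exact Submodule.smul_mem _ _ hg
      · exact Submodule.zero_mem _
    · rw [map_add]; exact Submodule.add_mem _ hf hg
  | succ N ih =>
    refine eigenspace_succ_induction (p := fun f => annihilation j f ∈ eigenspace n (N + 1))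
      (fun i g hg => ?_) (by simp) (fun f g hf hg => ?_) hf
    · rw [annihilation_creation]
      refine Submodule.add_mem _ (creation_mem_eigenspace (ih hg) i) ?_
      split_ifs
      · exact Submodule.smul_mem _ _ hg
      · exact Submodule.zero_mem _
    · rw [map_add]; exact Submodule.add_mem _ hf hg

/-- The energy of the Hermite functions of degree `N`. -/
noncomputable def energy (n N : ℕ) : ℝ := 2 * N + n

lemma hermiteCLM_eq_sum_creation_annihilation (f : 𝓢(EuclideanSpace ℝ (Fin n), ℂ)) :
    hermiteCLM f = ∑ i, creation i (annihilation i f) + (n : ℂ) • f := by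
  ext x
  have key : ∀ i : Fin n, creation i (annihilation i f) x
      = (coordMul i * coordMul i - partialDeriv i * partialDeriv i) f x - f x := by
    intro i
    have h := DFunLike.congr_fun (DFunLike.congr_fun (partialDeriv_mul_coordMul i i) f) x
    simp only [mul_apply_eq_comp, add_apply, if_true, one_apply_eq_self] at h
    simp only [creation, annihilation, sub_apply, add_apply, mul_apply_eq_comp, map_add, h]
    ring
  simp only [hermiteCLM, sum_apply, add_apply, key, smul_apply, Finset.sum_sub_distrib]
  simp

lemma hermiteCLM_of_mem {N : ℕ} {f : 𝓢(EuclideanSpace ℝ (Fin n), ℂ)}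
    (hf : f ∈ eigenspace n N) : hermiteCLM f = (energy n N : ℂ) • f := by
  induction N generalizing f with
  | zero =>
    rw [hermiteCLM_eq_sum_creation_annihilation]
    simp [annihilation_eq_zero_of_mem hf, energy]
  | succ N ih =>
    refine eigenspace_succ_induction (p := fun f => hermiteCLM f = (energy n (N + 1) : ℂ) • f)
      (fun i g hg => ?_) (by simp) (fun f g hf hg => ?_) hf
    · have h := DFunLike.congr_fun (hermiteCLM_mul_creation i) g
      simp only [mul_apply_eq_comp, add_apply, ih hg, map_smul, two_mul] at h
      rw [h, ← two_smul ℂ, ← add_smul]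
      congr 1
      simp only [energy]
      push_cast
      ring
    · rw [map_add, hf, hg, smul_add]

/-- The sum of the eigenspaces is stable under multiplication by coordinates, because
`2 xᵢ = aᵢ + aᵢ†`. -/
lemma coordMul_mem_iSup_eigenspace {f : 𝓢(EuclideanSpace ℝ (Fin n), ℂ)}
    (hf : f ∈ ⨆ N, eigenspace n N) (i : Fin n) : coordMul i f ∈ ⨆ N, eigenspace n N := by
  have h : ∀ g : 𝓢(EuclideanSpace ℝ (Fin n), ℂ),
      coordMul i g = (1 / 2 : ℂ) • (annihilation i g + creation i g) := by
    intro g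
    ext x
    simp [annihilation, creation]
    ring
  refine Submodule.iSup_induction _ (motive := fun f => coordMul i f ∈ ⨆ N, eigenspace n N) hf
    (fun N g hg => ?_) (by simp) (fun f g hf hg => ?_)
  · rw [h]
    refine Submodule.smul_mem _ _ (Submodule.add_mem _ ?_ ?_)
    · cases N with
      | zero => rw [annihilation_eq_zero_of_mem hg]; exact Submodule.zero_mem _
      | succ N => exact Submodule.mem_iSup_of_mem N (annihilation_mem_eigenspace hg i)
    · exact Submodule.mem_iSup_of_mem (N + 1) (creation_mem_eigenspace hg i)
  · rw [map_add]; exact Submodule.add_mem _ hf hg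

end Eigenspaces

/-! ### Completeness of the Hermite functions -/

section Completeness

open scoped FourierTransform in
/-- The Fourier transform is injective on integrable functions. -/
lemma ae_eq_zero_of_fourier_eq_zero {E : Type*} [NormedAddCommGroup E] [InnerProductSpace ℝ E]
    [FiniteDimensional ℝ E] [MeasurableSpace E] [BorelSpace E] {f : E → ℂ} (hf : Integrable f)
    (h : ∀ ξ, 𝓕 f ξ = 0) : f =ᵐ[volume] 0 := by
  refine ae_eq_zero_of_integral_contDiff_smul_eq_zero hf.locallyIntegrable fun g hg hgc => ?_
  have hc : HasCompactSupport (fun x => (g x : ℂ)) := hgc.comp_left Complex.ofReal_zero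
  have hs : ContDiff ℝ (⊤ : ℕ∞) (fun x => (g x : ℂ)) := Complex.ofRealCLM.contDiff.comp hg
  set φ : 𝓢(E, ℂ) := hc.toSchwartzMap hs with hφ
  have key : ∫ ξ, 𝓕 f ξ • (𝓕⁻ φ) ξ = ∫ x, f x • 𝓕 (𝓕⁻ φ) x := by
    rw [SchwartzMap.fourier_coe]
    simpa only [flip_innerₗ] using! VectorFourier.integral_fourierIntegral_smul_eq_flip
      (L := innerₗ E) (μ := (volume : Measure E)) (ν := (volume : Measure E))
      Real.continuous_fourierChar continuous_inner hf (𝓕⁻ φ).integrable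
  rw [FourierTransform.fourier_fourierInv_eq] at key
  simp only [h, zero_smul, integral_zero] at key
  rw [key]
  refine integral_congr_ae (Eventually.of_forall fun x => ?_)
  simp [hφ, mul_comm]

variable {n : ℕ}

lemma memLp_exp_norm_mul_gaussian (c : ℝ) :
    MemLp (fun x : EuclideanSpace ℝ (Fin n) => Real.exp (c * ‖x‖) * Real.exp (-(‖x‖ ^ 2 / 2)))
      2 volume := by
  have h1 : MemLp (fun x : EuclideanSpace ℝ (Fin n) => Real.exp (-(‖x‖ ^ 2 / 4))) 2 volume := by
    rw [memLp_two_iff_integrable_sq (by fun_prop)]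
    have := (gaussian (n := n)).integrable (μ := volume).norm
    refine this.congr (Eventually.of_forall fun x => ?_)
    simp only [gaussian_apply, Complex.norm_real, Real.norm_eq_abs, Real.abs_exp]
    rw [← Real.exp_nat_mul]
    congr 1
    push_cast
    ring
  -- completing the square: `c r - r² / 2 ≤ c² - r² / 4`
  refine (h1.const_mul (Real.exp (c ^ 2))).mono (by fun_prop) (Eventually.of_forall fun x => ?_)
  simp only [norm_mul, Real.norm_eq_abs, Real.abs_exp]
  rw [← Real.exp_add, ← Real.exp_add]
  refine Real.exp_le_exp.2 ?_
  nlinarith [sq_nonneg (‖x‖ / 2 - c)]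

/-- All moments of `gaussian * w` are pairings of `w` with functions in the sum of the
eigenspaces. -/
lemma exists_mem_iSup_eigenspace_inner_pow (ξ : EuclideanSpace ℝ (Fin n)) (k : ℕ) :
    ∃ f ∈ ⨆ N, eigenspace n N, ∀ x, f x = ((inner ℝ x ξ : ℝ) : ℂ) ^ k * gaussian x := by
  induction k with
  | zero =>
    exact ⟨gaussian, Submodule.mem_iSup_of_mem 0 (Submodule.mem_span_singleton_self _),
      fun x => by simp⟩
  | succ k ih =>
    obtain ⟨f, hf, hfx⟩ := ih
    refine ⟨∑ i, (ξ i : ℂ) • coordMul i f, Submodule.sum_mem _ fun i _ =>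
      Submodule.smul_mem _ _ (coordMul_mem_iSup_eigenspace hf i), fun x => ?_⟩
    rw [pow_succ', mul_assoc, ← hfx, sum_apply, PiLp.inner_apply]
    simp only [smul_apply, coordMul_apply, smul_eq_mul]
    push_cast
    rw [Finset.sum_mul]
    refine Finset.sum_congr rfl fun i _ => ?_
    simp
    ring

open scoped FourierTransform in
/-- The Hermite functions are complete in `L²(ℝⁿ)`: if `w` is orthogonal to all of them, the
exponential series shows that the Fourier transform of `gaussian * w` vanishes. -/
lemma eq_zero_of_integral_eigenspace_mul_eq_zero (w : L2 n)
    (hw : ∀ N, ∀ f ∈ eigenspace n N, ∫ x, f x * w x = 0) : w = 0 := by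
  have hint : ∀ f : 𝓢(EuclideanSpace ℝ (Fin n), ℂ), Integrable (fun x => f x * w x) := fun f =>
    MemLp.integrable_mul (p := 2) (q := 2) (f.memLp 2) (Lp.memLp w)
  have hw' : ∀ f ∈ ⨆ N, eigenspace n N, ∫ x, f x * w x = 0 := by
    intro f hf
    refine Submodule.iSup_induction _ (motive := fun f : 𝓢(EuclideanSpace ℝ (Fin n), ℂ) =>
      ∫ x, f x * w x = 0) hf hw (by simp) fun f g hf hg => ?_
    simp only [add_apply, add_mul]
    rw [integral_add (hint f) (hint g), hf, hg, add_zero]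
  have hexp : ∀ c : ℝ, Integrable (fun x => Real.exp (c * ‖x‖) * ‖gaussian x * w x‖) := by
    intro c
    have h := MemLp.integrable_mul (p := 2) (q := 2) (memLp_exp_norm_mul_gaussian (n := n) c)
      (Lp.memLp w).norm
    refine h.congr (Eventually.of_forall fun x => ?_)
    simp only [gaussian_apply, norm_mul, Complex.norm_real, Real.norm_eq_abs, Real.abs_exp,
      Pi.mul_apply]
    ring
  have hzero : (fun x => gaussian x * w x) =ᵐ[volume] 0 := by
    refine ae_eq_zero_of_fourier_eq_zero (hint gaussian) fun ξ => ?_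
    have hsum := hasSum_integral_of_dominated_convergence (μ := volume)
      (F := fun (k : ℕ) (x : EuclideanSpace ℝ (Fin n)) =>
        ((k.factorial : ℂ)⁻¹ * (-2 * Real.pi * Complex.I) ^ k) *
          (((inner ℝ x ξ : ℝ) : ℂ) ^ k * gaussian x * w x))
      (f := fun x => Complex.exp (-2 * Real.pi * Complex.I * (inner ℝ x ξ : ℝ))
        * (gaussian x * w x))
      (fun k x => (k.factorial : ℝ)⁻¹ * (2 * Real.pi * ‖ξ‖ * ‖x‖) ^ k * ‖gaussian x * w x‖)
      (fun k => ?_) (fun k => Eventually.of_forall fun x => ?_)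
      (Eventually.of_forall fun x => ?_) ?_ (Eventually.of_forall fun x => ?_)
    · have h0 : ∀ k : ℕ, ∫ x : EuclideanSpace ℝ (Fin n),
          ((k.factorial : ℂ)⁻¹ * (-2 * Real.pi * Complex.I) ^ k) *
          (((inner ℝ x ξ : ℝ) : ℂ) ^ k * gaussian x * w x) = 0 := by
        intro k
        obtain ⟨f, hf, hfx⟩ := exists_mem_iSup_eigenspace_inner_pow ξ k
        rw [integral_const_mul]
        simp_rw [← hfx]
        rw [hw' f hf, mul_zero]
      simp only [h0] at hsum
      have := hsum.unique hasSum_zero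
      rw [Real.fourier_eq', ← this]
      refine integral_congr_ae (Eventually.of_forall fun x => ?_)
      simp only [smul_eq_mul]
      congr 2
      push_cast
      ring
    · refine AEStronglyMeasurable.const_mul ?_ _
      have : Continuous fun x : EuclideanSpace ℝ (Fin n) =>
          ((inner ℝ x ξ : ℝ) : ℂ) ^ k * gaussian x := by fun_prop
      exact this.aestronglyMeasurable.mul (Lp.aestronglyMeasurable w)
    · have hin : ‖((inner ℝ x ξ : ℝ) : ℂ)‖ ≤ ‖ξ‖ * ‖x‖ := by
        rw [Complex.norm_real, mul_comm]
        exact norm_inner_le_norm x ξ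
      have hpi : ‖(-2 * Real.pi * Complex.I : ℂ)‖ = 2 * Real.pi := by
        simp [abs_of_pos Real.pi_pos]
      rw [mul_assoc _ (gaussian x), norm_mul, norm_mul, norm_mul _ (gaussian x * w x), norm_pow,
        norm_pow, hpi, norm_inv, Complex.norm_natCast]
      calc _ ≤ (k.factorial : ℝ)⁻¹ * (2 * Real.pi) ^ k
            * ((‖ξ‖ * ‖x‖) ^ k * ‖gaussian x * w x‖) := by
            gcongr
        _ = _ := by
            rw [show 2 * Real.pi * ‖ξ‖ * ‖x‖ = 2 * Real.pi * (‖ξ‖ * ‖x‖) by ring, mul_pow]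
            ring
    · refine Summable.mul_right _ ?_
      simpa [div_eq_inv_mul] using Real.summable_pow_div_factorial (2 * Real.pi * ‖ξ‖ * ‖x‖)
    · refine (hexp (2 * Real.pi * ‖ξ‖)).congr (Eventually.of_forall fun x => ?_)
      simp only [tsum_mul_right]
      congr 1
      rw [Real.exp_eq_exp_ℝ, NormedSpace.exp_eq_tsum_div]
      simp only [div_eq_inv_mul]
    · have h := NormedSpace.expSeries_div_hasSum_exp
        (-2 * Real.pi * Complex.I * ((inner ℝ x ξ : ℝ) : ℂ))
      rw [← Complex.exp_eq_exp_ℂ] at h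
      refine (h.mul_right (gaussian x * w x)).congr_fun ?_
      intro k
      rw [mul_pow]
      ring
  rw [Lp.eq_zero_iff_ae_eq_zero]
  filter_upwards [hzero] with x hx
  simpa [gaussian_apply] using hx

end Completeness

/-! ### Radial operators and the `sl₂` triple -/

section Radial

variable {n : ℕ}

/-- Pointwise complex conjugation of Schwartz functions. -/
noncomputable def conjSchwartz :
    𝓢(EuclideanSpace ℝ (Fin n), ℂ) →L[ℝ] 𝓢(EuclideanSpace ℝ (Fin n), ℂ) :=
  SchwartzMap.postcompCLM (Complex.conjCLE : ℂ →L[ℝ] ℂ)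

@[simp]
lemma conjSchwartz_apply (f : 𝓢(EuclideanSpace ℝ (Fin n), ℂ)) (x : EuclideanSpace ℝ (Fin n)) :
    conjSchwartz f x = (starRingEnd ℂ) (f x) := rfl

lemma fderiv_conjSchwartz (f : 𝓢(EuclideanSpace ℝ (Fin n), ℂ)) (x v : EuclideanSpace ℝ (Fin n)) :
    fderiv ℝ (conjSchwartz f) x v = (starRingEnd ℂ) (fderiv ℝ f x v) := by
  have h := ((Complex.conjCLE : ℂ →L[ℝ] ℂ).hasFDerivAt.comp x (f.hasFDerivAt x)).fderiv
  change fderiv ℝ ((Complex.conjCLE : ℂ →L[ℝ] ℂ) ∘ f) x v = _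
  rw [h]
  rfl

lemma conjSchwartz_creation (i : Fin n) (f : 𝓢(EuclideanSpace ℝ (Fin n), ℂ)) :
    conjSchwartz (creation i f) = creation i (conjSchwartz f) := by
  ext x
  simp [creation, partialDeriv_apply, fderiv_conjSchwartz]

/-- `aᵢ†` is the adjoint of `aᵢ` for the `L²` inner product. -/
lemma inner_creation (i : Fin n) (f g : 𝓢(EuclideanSpace ℝ (Fin n), ℂ)) :
    inner ℂ ((creation i f).toLp 2 volume) (g.toLp 2 volume)
      = inner ℂ (f.toLp 2 volume) ((annihilation i g).toLp 2 volume) := by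
  rw [SchwartzMap.inner_toL2_toL2_eq _ _ volume, SchwartzMap.inner_toL2_toL2_eq _ _ volume]
  have h := integral_creation_mul i (conjSchwartz f) g
  rw [← conjSchwartz_creation] at h
  simp only [conjSchwartz_apply] at h
  simpa only [RCLike.inner_apply, mul_comm] using h

lemma conjSchwartz_hermiteCLM (f : 𝓢(EuclideanSpace ℝ (Fin n), ℂ)) :
    conjSchwartz (hermiteCLM f) = hermiteCLM (conjSchwartz f) := by
  have h : ∀ (i : Fin n) (g : 𝓢(EuclideanSpace ℝ (Fin n), ℂ)),
      conjSchwartz (partialDeriv i g) = partialDeriv i (conjSchwartz g) := by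
    intro i g
    ext x
    simp [partialDeriv_apply, fderiv_conjSchwartz]
  ext x
  simp only [hermiteCLM, sum_apply, sub_apply, mul_apply_eq_comp, ← h, conjSchwartz_apply,
    map_sum, map_sub, coordMul_apply, map_mul, Complex.conj_ofReal]

lemma inner_hermiteCLM (f g : 𝓢(EuclideanSpace ℝ (Fin n), ℂ)) :
    inner ℂ ((hermiteCLM f).toLp 2 volume) (g.toLp 2 volume)
      = inner ℂ (f.toLp 2 volume) ((hermiteCLM g).toLp 2 volume) := by
  rw [SchwartzMap.inner_toL2_toL2_eq _ _ volume, SchwartzMap.inner_toL2_toL2_eq _ _ volume]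
  have h := integral_hermiteCLM_mul (conjSchwartz f) g
  rw [← conjSchwartz_hermiteCLM] at h
  simp only [conjSchwartz_apply] at h
  simpa only [RCLike.inner_apply, mul_comm] using h

/-- Multiplication by `|x|²`. -/
noncomputable def normSqMul :
    𝓢(EuclideanSpace ℝ (Fin n), ℂ) →L[ℂ] 𝓢(EuclideanSpace ℝ (Fin n), ℂ) :=
  ∑ i, coordMul i * coordMul i

/-- The Euler vector field `x · ∇`, the generator of dilations. -/
noncomputable def eulerField :
    𝓢(EuclideanSpace ℝ (Fin n), ℂ) →L[ℂ] 𝓢(EuclideanSpace ℝ (Fin n), ℂ) :=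
  ∑ i, coordMul i * partialDeriv i

/-- The operator `∑ᵢ aᵢ²`, which lowers the degree of a Hermite function by two. -/
noncomputable def lowering :
    𝓢(EuclideanSpace ℝ (Fin n), ℂ) →L[ℂ] 𝓢(EuclideanSpace ℝ (Fin n), ℂ) :=
  ∑ i, annihilation i * annihilation i

/-- The operator `∑ᵢ (aᵢ†)²`, which raises the degree of a Hermite function by two. -/
noncomputable def raising :
    𝓢(EuclideanSpace ℝ (Fin n), ℂ) →L[ℂ] 𝓢(EuclideanSpace ℝ (Fin n), ℂ) :=
  ∑ i, creation i * creation i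

lemma normSqMul_apply (f : 𝓢(EuclideanSpace ℝ (Fin n), ℂ)) (x : EuclideanSpace ℝ (Fin n)) :
    normSqMul f x = ((‖x‖ ^ 2 : ℝ) : ℂ) * f x := by
  rw [EuclideanSpace.norm_sq_eq]
  simp only [normSqMul, sum_apply, mul_apply_eq_comp, coordMul_apply, Real.norm_eq_abs, sq_abs]
  push_cast
  rw [Finset.sum_mul]
  exact Finset.sum_congr rfl fun i _ => by ring

lemma eulerField_apply (f : 𝓢(EuclideanSpace ℝ (Fin n), ℂ)) (x : EuclideanSpace ℝ (Fin n)) :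
    eulerField f x = fderiv ℝ f x x := by
  have h : x = ∑ i, x i • EuclideanSpace.single i (1 : ℝ) := by
    simpa using ((EuclideanSpace.basisFun (Fin n) ℝ).sum_repr x).symm
  have h' := congrArg (fderiv ℝ f x) h
  rw [map_sum] at h'
  rw [h']
  simp [eulerField, partialDeriv_apply]

lemma lowering_eq (f : 𝓢(EuclideanSpace ℝ (Fin n), ℂ)) :
    lowering f = (2 : ℂ) • normSqMul f + (2 : ℂ) • eulerField f + (n : ℂ) • f - hermiteCLM f := by
  have key : ∀ i : Fin n, (annihilation i * annihilation i) f
      = (2 : ℂ) • (coordMul i * coordMul i) f + (2 : ℂ) • (coordMul i * partialDeriv i) f + f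
        - (coordMul i * coordMul i - partialDeriv i * partialDeriv i) f := by
    intro i
    have h := DFunLike.congr_fun (partialDeriv_mul_coordMul i i) f
    simp only [mul_apply_eq_comp, add_apply, if_true, one_apply_eq_self] at h
    simp only [annihilation, sub_apply, add_apply, mul_apply_eq_comp, map_add, h]
    module
  simp only [lowering, normSqMul, eulerField, hermiteCLM, sum_apply, key, Finset.sum_sub_distrib,
    Finset.sum_add_distrib, Finset.smul_sum, sub_apply]
  simp [Nat.cast_smul_eq_nsmul]

lemma raising_eq (f : 𝓢(EuclideanSpace ℝ (Fin n), ℂ)) :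
    raising f = (2 : ℂ) • normSqMul f - (2 : ℂ) • eulerField f - (n : ℂ) • f - hermiteCLM f := by
  have key : ∀ i : Fin n, (creation i * creation i) f
      = (2 : ℂ) • (coordMul i * coordMul i) f - (2 : ℂ) • (coordMul i * partialDeriv i) f - f
        - (coordMul i * coordMul i - partialDeriv i * partialDeriv i) f := by
    intro i
    have h := DFunLike.congr_fun (partialDeriv_mul_coordMul i i) f
    simp only [mul_apply_eq_comp, add_apply, if_true, one_apply_eq_self] at h
    simp only [creation, sub_apply, mul_apply_eq_comp, map_sub, h]
    module
  simp only [raising, normSqMul, eulerField, hermiteCLM, sum_apply, key, Finset.sum_sub_distrib,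
    Finset.smul_sum, sub_apply]
  simp [Nat.cast_smul_eq_nsmul]

lemma inner_raising (f g : 𝓢(EuclideanSpace ℝ (Fin n), ℂ)) :
    inner ℂ ((raising f).toLp 2 volume) (g.toLp 2 volume)
      = inner ℂ (f.toLp 2 volume) ((lowering g).toLp 2 volume) := by
  simp only [← SchwartzMap.toLpCLM_apply (𝕜 := ℂ), raising, lowering, sum_apply, map_sum, sum_inner,
    inner_sum, mul_apply_eq_comp]
  simp only [SchwartzMap.toLpCLM_apply, inner_creation]

lemma raising_mem_eigenspace {N : ℕ} {f : 𝓢(EuclideanSpace ℝ (Fin n), ℂ)}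
    (hf : f ∈ eigenspace n N) : raising f ∈ eigenspace n (N + 2) := by
  simp only [raising, sum_apply, mul_apply_eq_comp]
  exact Submodule.sum_mem _ fun i _ => creation_mem_eigenspace (creation_mem_eigenspace hf i) i

lemma lowering_mem_eigenspace {N : ℕ} {f : 𝓢(EuclideanSpace ℝ (Fin n), ℂ)}
    (hf : f ∈ eigenspace n (N + 2)) : lowering f ∈ eigenspace n N := by
  simp only [lowering, sum_apply, mul_apply_eq_comp]
  exact Submodule.sum_mem _ fun i _ =>
    annihilation_mem_eigenspace (annihilation_mem_eigenspace hf i) i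

lemma lowering_eq_zero_of_mem {N : ℕ} (hN : N < 2) {f : 𝓢(EuclideanSpace ℝ (Fin n), ℂ)}
    (hf : f ∈ eigenspace n N) : lowering f = 0 := by
  simp only [lowering, sum_apply, mul_apply_eq_comp]
  refine Finset.sum_eq_zero fun i _ => ?_
  interval_cases N
  · rw [annihilation_eq_zero_of_mem hf, map_zero]
  · exact annihilation_eq_zero_of_mem (annihilation_mem_eigenspace hf i) i

end Radial

/-! ### The inverse square weight in dimension three -/

section InverseSquare

lemma integrable_inv_norm_sq_mul_one_add_norm :
    Integrable (fun x : EuclideanSpace ℝ (Fin 3) => (‖x‖ ^ 2)⁻¹ * (1 + ‖x‖) ^ (-4 : ℝ)) := by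
  have h1 : LocallyIntegrable (fun x : EuclideanSpace ℝ (Fin 3) => (‖x‖ ^ 2)⁻¹) volume := by
    refine locallyIntegrable_of_norm_le_rpow (C := 1) (α := 2) (by simp) (by simp; norm_num)
      (Eventually.of_forall fun x => ?_) (Measurable.aestronglyMeasurable (by fun_prop))
    · rw [Real.norm_of_nonneg (by positivity), one_mul, Real.rpow_neg (norm_nonneg _)]
      norm_num
  have h2 : Integrable ((Metric.closedBall (0 : EuclideanSpace ℝ (Fin 3)) 1).indicator
      (fun x => (‖x‖ ^ 2)⁻¹)) :=
    (h1.integrableOn_isCompact (isCompact_closedBall _ _)).integrable_indicator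
      Metric.isClosed_closedBall.measurableSet
  have h3 : Integrable (fun x : EuclideanSpace ℝ (Fin 3) => (1 + ‖x‖) ^ (-4 : ℝ)) :=
    integrable_one_add_norm (by simp; norm_num)
  refine (h2.add h3).mono' (Measurable.aestronglyMeasurable (by fun_prop))
    (Eventually.of_forall fun x => ?_)
  have hp : 0 ≤ (1 + ‖x‖) ^ (-4 : ℝ) := by positivity
  rw [Real.norm_of_nonneg (by positivity), Pi.add_apply]
  by_cases hx : x ∈ Metric.closedBall (0 : EuclideanSpace ℝ (Fin 3)) 1
  · rw [Set.indicator_of_mem hx]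
    have : (1 + ‖x‖) ^ (-4 : ℝ) ≤ 1 :=
      Real.rpow_le_one_of_one_le_of_nonpos (by have := norm_nonneg x; linarith) (by norm_num)
    have h0 : 0 ≤ (‖x‖ ^ 2)⁻¹ := by positivity
    nlinarith
  · rw [Set.indicator_of_notMem hx, zero_add]
    have hx' : 1 ≤ ‖x‖ := by simpa using (not_le.1 (by simpa using hx)).le
    have : (‖x‖ ^ 2)⁻¹ ≤ 1 := inv_le_one_of_one_le₀ (one_le_pow₀ hx')
    nlinarith

/-- Schwartz functions decay like `(1 + |x|)⁻⁴`, which is integrable on `ℝ³`. -/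
lemma exists_norm_le_one_add_norm_rpow (f : 𝓢(EuclideanSpace ℝ (Fin 3), ℂ)) :
    ∃ C : ℝ, 0 ≤ C ∧ ∀ x, ‖f x‖ ≤ C * (1 + ‖x‖) ^ (-4 : ℝ) := by
  refine ⟨2 ^ 4 * (((Finset.Iic (4, 0)).sup
    fun m => SchwartzMap.seminorm ℝ m.1 m.2) f), by positivity, fun x => ?_⟩
  have h := SchwartzMap.one_add_le_sup_seminorm_apply (𝕜 := ℝ) (m := (4, 0)) (k := 4) (n := 0)
    le_rfl le_rfl f x
  rw [norm_iteratedFDeriv_zero] at h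
  rw [Real.rpow_neg (by positivity), ← div_eq_mul_inv, le_div_iff₀ (by positivity)]
  have e : (1 + ‖x‖) ^ (4 : ℝ) = (1 + ‖x‖) ^ 4 := by
    exact_mod_cast Real.rpow_natCast (1 + ‖x‖) 4
  rw [e, mul_comm]
  exact h

lemma integrable_inv_norm_sq_mul (f : 𝓢(EuclideanSpace ℝ (Fin 3), ℂ)) :
    Integrable (fun x => (((‖x‖ ^ 2)⁻¹ : ℝ) : ℂ) * f x) := by
  obtain ⟨C, -, hC⟩ := exists_norm_le_one_add_norm_rpow f
  refine (integrable_inv_norm_sq_mul_one_add_norm.const_mul C).mono'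
    (Measurable.aestronglyMeasurable ?_) (Eventually.of_forall fun x => ?_)
  · have := f.continuous.measurable
    fun_prop
  · rw [norm_mul, Complex.norm_real, Real.norm_of_nonneg (by positivity)]
    have := hC x
    calc _ ≤ (‖x‖ ^ 2)⁻¹ * (C * (1 + ‖x‖) ^ (-4 : ℝ)) := by gcongr
      _ = _ := by ring

/-- The weight `|x|⁻²` is homogeneous of degree `-2`, so on `ℝ³` the formal transpose of
`x · ∇` against it is `-1`. Obtained by differentiating the scaling `x ↦ s x` at `s = 1`. -/
lemma integral_inv_norm_sq_mul_eulerField (f : 𝓢(EuclideanSpace ℝ (Fin 3), ℂ)) :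
    ∫ x, (((‖x‖ ^ 2)⁻¹ : ℝ) : ℂ) * eulerField f x = -∫ x, (((‖x‖ ^ 2)⁻¹ : ℝ) : ℂ) * f x := by
  obtain ⟨C, hC0, hC⟩ := exists_norm_le_one_add_norm_rpow (eulerField f)
  set G : ℝ → ℂ := fun s => ∫ x : EuclideanSpace ℝ (Fin 3), (((‖x‖ ^ 2)⁻¹ : ℝ) : ℂ) * f (s • x)
    with hG
  have hfm := f.continuous.measurable
  -- for `1/2 < s < 2` the integrand has `s`-derivative `s⁻¹ |x|⁻² (x · ∇f)(s x)`; the constant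
  -- `32` below is the product of `s⁻¹ ≤ 2` and of `2⁴`, lost in replacing `s x` by `x`
  have hderiv : HasDerivAt G (∫ x, (((‖x‖ ^ 2)⁻¹ : ℝ) : ℂ) * fderiv ℝ f ((1 : ℝ) • x) x) 1 := by
    refine (hasDerivAt_integral_of_dominated_loc_of_deriv_le (μ := volume)
      (F' := fun s x => (((‖x‖ ^ 2)⁻¹ : ℝ) : ℂ) * fderiv ℝ f (s • x) x)
      (bound := fun x => 32 * C * ((‖x‖ ^ 2)⁻¹ * (1 + ‖x‖) ^ (-4 : ℝ)))
      (Ioo_mem_nhds (show (1 / 2 : ℝ) < 1 by norm_num) (show (1 : ℝ) < 2 by norm_num))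
      (Eventually.of_forall fun s => Measurable.aestronglyMeasurable ?_) ?_
      (Measurable.aestronglyMeasurable ?_) (Eventually.of_forall fun x s hs => ?_)
      (integrable_inv_norm_sq_mul_one_add_norm.const_mul _)
      (Eventually.of_forall fun x s hs => ?_)).2
    · fun_prop
    · simpa using integrable_inv_norm_sq_mul f
    · have h0 := (eulerField f).continuous.measurable
      have : (fun x => (((‖x‖ ^ 2)⁻¹ : ℝ) : ℂ) * fderiv ℝ f ((1 : ℝ) • x) x)
          = fun x => (((‖x‖ ^ 2)⁻¹ : ℝ) : ℂ) * eulerField f x := by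
        ext x; rw [eulerField_apply, one_smul]
      rw [this]
      fun_prop
    · have hs0 : 0 < s := by linarith [hs.1]
      have h1 : fderiv ℝ f (s • x) x = ((s⁻¹ : ℝ) : ℂ) * eulerField f (s • x) := by
        rw [eulerField_apply, map_smul, Complex.real_smul, ← mul_assoc, ← Complex.ofReal_mul,
          inv_mul_cancel₀ hs0.ne', Complex.ofReal_one, one_mul]
      have h2 : (1 + ‖s • x‖) ^ (-4 : ℝ) ≤ 16 * (1 + ‖x‖) ^ (-4 : ℝ) := by
        have h3 : (1 + ‖x‖) / 2 ≤ 1 + ‖s • x‖ := by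
          rw [norm_smul, Real.norm_of_nonneg hs0.le]
          nlinarith [norm_nonneg x, hs.1]
        calc (1 + ‖s • x‖) ^ (-4 : ℝ) ≤ ((1 + ‖x‖) / 2) ^ (-4 : ℝ) :=
              Real.rpow_le_rpow_of_nonpos (by positivity) h3 (by norm_num)
          _ = 16 * (1 + ‖x‖) ^ (-4 : ℝ) := by
              rw [Real.div_rpow (by positivity) (by norm_num),
                Real.rpow_neg (by norm_num : (0 : ℝ) ≤ 2)]
              norm_num
              ring
      have h4 : s⁻¹ ≤ 2 := by
        rw [inv_le_comm₀ hs0 (by norm_num)]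
        linarith [hs.1]
      rw [h1, norm_mul, norm_mul, Complex.norm_real, Complex.norm_real,
        Real.norm_of_nonneg (by positivity), Real.norm_of_nonneg (by positivity)]
      calc _ ≤ (‖x‖ ^ 2)⁻¹ * (2 * (C * (16 * (1 + ‖x‖) ^ (-4 : ℝ)))) := by
            gcongr
            exact (hC _).trans (by gcongr)
        _ = _ := by ring
    · have h1 : HasDerivAt (fun s : ℝ => s • x) x s := by
        simpa using (hasDerivAt_id s).smul_const x
      exact ((f.hasFDerivAt (s • x)).comp_hasDerivAt s h1).const_mul _
  -- the weight scales by `s²` and Lebesgue measure by `s⁻³`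
  have hscale : ∀ s : ℝ, 0 < s → G s = (s⁻¹ : ℝ) • G 1 := by
    intro s hs
    have h := Measure.integral_comp_smul (volume : Measure (EuclideanSpace ℝ (Fin 3)))
      (fun y => (((‖y‖ ^ 2)⁻¹ : ℝ) : ℂ) * f y) s
    have e : ∀ x : EuclideanSpace ℝ (Fin 3), (((‖x‖ ^ 2)⁻¹ : ℝ) : ℂ) * f (s • x)
        = ((s ^ 2 : ℝ) : ℂ) * ((((‖s • x‖ ^ 2)⁻¹ : ℝ) : ℂ) * f (s • x)) := by
      intro x
      rw [← mul_assoc, ← Complex.ofReal_mul, norm_smul, Real.norm_of_nonneg hs.le, mul_pow,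
        mul_inv, ← mul_assoc, mul_inv_cancel₀ (by positivity), one_mul]
    simp only [hG, one_smul]
    simp_rw [e]
    rw [integral_const_mul, h]
    rw [Complex.real_smul, Complex.real_smul, ← mul_assoc, ← Complex.ofReal_mul]
    congr 2
    rw [finrank_euclideanSpace_fin, abs_of_pos (by positivity)]
    field_simp
  have hderiv' : HasDerivAt G (-G 1) 1 := by
    have h1 : HasDerivAt (fun s : ℝ => (s⁻¹ : ℝ) • G 1) (-G 1) 1 := by
      simpa using (hasDerivAt_inv (one_ne_zero (α := ℝ))).smul_const (G 1)
    refine h1.congr_of_eventuallyEq ?_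
    filter_upwards [lt_mem_nhds (zero_lt_one (α := ℝ))] with s hs using hscale s hs
  have h := hderiv.unique hderiv'
  simp only [hG, one_smul] at h
  simpa only [eulerField_apply] using h

lemma memLp_inv_norm_mul (f : 𝓢(EuclideanSpace ℝ (Fin 3), ℂ)) :
    MemLp (fun x => ((‖x‖⁻¹ : ℝ) : ℂ) * f x) 2 volume := by
  have hfm := f.continuous.measurable
  rw [memLp_two_iff_integrable_sq_norm (Measurable.aestronglyMeasurable (by fun_prop))]
  have h := (integrable_inv_norm_sq_mul
    (SchwartzMap.pairing (ContinuousLinearMap.mul ℝ ℂ) (conjSchwartz f) f)).norm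
  refine h.congr (Eventually.of_forall fun x => ?_)
  simp only [SchwartzMap.pairing_apply_apply, norm_mul, Complex.norm_real, norm_inv, norm_norm,
    norm_pow, conjSchwartz_apply, ContinuousLinearMap.mul_apply', RCLike.norm_conj]
  ring

/-- The map `f ↦ |x|⁻¹ f` from Schwartz functions on `ℝ³` to `L²(ℝ³)`. -/
noncomputable def invNormMul : 𝓢(EuclideanSpace ℝ (Fin 3), ℂ) →ₗ[ℂ] L2 3 where
  toFun f := (memLp_inv_norm_mul f).toLp _
  map_add' f g := by
    rw [← MemLp.toLp_add]
    congr 1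
    ext x
    simp [mul_add]
  map_smul' c f := by
    rw [RingHom.id_apply, ← MemLp.toLp_const_smul]
    congr 1
    ext x
    simp
    ring

lemma coeFn_invNormMul (f : 𝓢(EuclideanSpace ℝ (Fin 3), ℂ)) :
    invNormMul f =ᵐ[volume] fun x => ((‖x‖⁻¹ : ℝ) : ℂ) * f x :=
  (memLp_inv_norm_mul f).coeFn_toLp

lemma inner_invNormMul (f g : 𝓢(EuclideanSpace ℝ (Fin 3), ℂ)) :
    inner ℂ (invNormMul f) (invNormMul g)
      = ∫ x, (((‖x‖ ^ 2)⁻¹ : ℝ) : ℂ) * ((starRingEnd ℂ) (f x) * g x) := by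
  refine integral_congr_ae ?_
  filter_upwards [coeFn_invNormMul f, coeFn_invNormMul g] with x hf hg
  rw [hf, hg, RCLike.inner_apply, map_mul, Complex.conj_ofReal]
  push_cast
  ring

lemma inner_invNormMul_normSqMul (f g : 𝓢(EuclideanSpace ℝ (Fin 3), ℂ)) :
    inner ℂ (invNormMul f) (invNormMul (normSqMul g))
      = inner ℂ (f.toLp 2 volume) (g.toLp 2 volume) := by
  rw [inner_invNormMul, SchwartzMap.inner_toL2_toL2_eq _ _ volume]
  refine integral_congr_ae ?_
  have h0 : ∀ᵐ x : EuclideanSpace ℝ (Fin 3), x ≠ 0 := by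
    simp [ae_iff]
  filter_upwards [h0] with x hx
  have : ((‖x‖ : ℝ) : ℂ) ≠ 0 := by simpa using hx
  rw [normSqMul_apply, RCLike.inner_apply]
  push_cast
  field_simp

lemma inner_invNormMul_normSqMul_left (f g : 𝓢(EuclideanSpace ℝ (Fin 3), ℂ)) :
    inner ℂ (invNormMul (normSqMul f)) (invNormMul g)
      = inner ℂ (f.toLp 2 volume) (g.toLp 2 volume) := by
  rw [← inner_conj_symm, inner_invNormMul_normSqMul, inner_conj_symm]

lemma inner_invNormMul_eulerField (f g : 𝓢(EuclideanSpace ℝ (Fin 3), ℂ)) :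
    inner ℂ (invNormMul (eulerField f)) (invNormMul g)
      + inner ℂ (invNormMul f) (invNormMul (eulerField g))
      = -inner ℂ (invNormMul f) (invNormMul g) := by
  let M := ContinuousLinearMap.mul ℝ ℂ
  have h := integral_inv_norm_sq_mul_eulerField (SchwartzMap.pairing M (conjSchwartz f) g)
  have e : ∀ x, eulerField (SchwartzMap.pairing M (conjSchwartz f) g) x
      = (starRingEnd ℂ) (eulerField f x) * g x + (starRingEnd ℂ) (f x) * eulerField g x := by
    intro x
    have hd := (((conjSchwartz f).hasFDerivAt x).mul (g.hasFDerivAt x)).fderiv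
    rw [eulerField_apply]
    change fderiv ℝ (fun y => conjSchwartz f y * g y) x x = _
    erw [hd]
    simp only [add_apply, smul_apply, fderiv_conjSchwartz, smul_eq_mul, conjSchwartz_apply,
      eulerField_apply]
    ring
  rw [inner_invNormMul, inner_invNormMul, inner_invNormMul]
  have i1 := integrable_inv_norm_sq_mul (SchwartzMap.pairing M (conjSchwartz (eulerField f)) g)
  have i2 := integrable_inv_norm_sq_mul (SchwartzMap.pairing M (conjSchwartz f) (eulerField g))
  refine (integral_add i1 i2).symm.trans ?_
  refine Eq.trans ?_ h
  refine integral_congr_ae (Eventually.of_forall fun x => ?_)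
  simp only [e]
  simp only [M, SchwartzMap.pairing_apply_apply, conjSchwartz_apply,
    ContinuousLinearMap.mul_apply']
  ring

end InverseSquare

/-! ### The weighted bound on eigenspaces -/

section EigenspaceBound

lemma inner_self_eq_ofReal_norm_sq {G : Type*} [NormedAddCommGroup G] [InnerProductSpace ℂ G]
    (v : G) : inner ℂ v v = ((‖v‖ ^ 2 : ℝ) : ℂ) := by
  rw [inner_self_eq_norm_sq_to_K]
  norm_cast

/-- A linear map `A` on a finite-dimensional inner product space has operator norm at most `√C` as
soon as every eigenvalue of `A† A` is at most `C`. The eigenvalue equation is stated weakly, so that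
it can be checked without computing the adjoint. -/
lemma norm_sq_le_of_eigenvalue_le {F G : Type*} [NormedAddCommGroup F] [InnerProductSpace ℂ F]
    [FiniteDimensional ℂ F] [NormedAddCommGroup G] [InnerProductSpace ℂ G] [CompleteSpace G]
    (A : F →ₗ[ℂ] G) (C : ℝ)
    (h : ∀ v ≠ 0, ∀ μ : ℝ, (∀ w, inner ℂ (A w) (A v) = μ * inner ℂ w v) → μ ≤ C) (v : F) :
    ‖A v‖ ^ 2 ≤ C * ‖v‖ ^ 2 := by
  have : CompleteSpace F := FiniteDimensional.complete ℂ F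
  set B : F →L[ℂ] G := LinearMap.toContinuousLinearMap A with hB
  have hBA : ∀ w, B w = A w := fun w => rfl
  set T : F →ₗ[ℂ] F := (ContinuousLinearMap.adjoint B ∘L B).toLinearMap with hT
  have hTi : ∀ w v, inner ℂ w (T v) = inner ℂ (A w) (A v) := by
    intro w v
    simp only [hT, ContinuousLinearMap.coe_coe, ContinuousLinearMap.comp_apply,
      ContinuousLinearMap.adjoint_inner_right, hBA]
  have hsymm : T.IsSymmetric := by
    intro w v
    rw [hTi, ← inner_conj_symm, hTi, inner_conj_symm]
  set b := hsymm.eigenvectorBasis rfl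
  set ev := hsymm.eigenvalues rfl
  have hTb : ∀ i, T (b i) = (ev i : ℂ) • b i := fun i => hsymm.apply_eigenvectorBasis rfl i
  have hev : ∀ i, ev i ≤ C := by
    intro i
    refine h (b i) (b.orthonormal.ne_zero i) (ev i) fun w => ?_
    rw [← hTi, hTb, inner_smul_right]
  have e1 : ((‖A v‖ ^ 2 : ℝ) : ℂ) = ((∑ i, ev i * ‖inner ℂ (b i) v‖ ^ 2 : ℝ) : ℂ) := by
    rw [← inner_self_eq_ofReal_norm_sq, ← hTi, ← b.sum_inner_mul_inner]
    push_cast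
    refine Finset.sum_congr rfl fun i _ => ?_
    rw [← hsymm, hTb, inner_smul_left, Complex.conj_ofReal, ← inner_conj_symm v]
    linear_combination (ev i : ℂ) * Complex.conj_mul' (inner ℂ (b i) v)
  have e2 : ‖v‖ ^ 2 = ∑ i, ‖inner ℂ (b i) v‖ ^ 2 := (b.sum_sq_norm_inner_right v).symm
  rw [Complex.ofReal_inj.1 e1, e2, Finset.mul_sum]
  exact Finset.sum_le_sum fun i _ => by gcongr; exact hev i

lemma inner_invNormMul_lowering {a : ℝ} {f : 𝓢(EuclideanSpace ℝ (Fin 3), ℂ)}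
    (hf : hermiteCLM f = (a : ℂ) • f) (g : 𝓢(EuclideanSpace ℝ (Fin 3), ℂ)) :
    inner ℂ (invNormMul (lowering f)) (invNormMul g)
      = 2 * inner ℂ (f.toLp 2 volume) (g.toLp 2 volume)
        + 2 * inner ℂ (invNormMul (eulerField f)) (invNormMul g)
        + (3 - a) * inner ℂ (invNormMul f) (invNormMul g) := by
  rw [lowering_eq, hf]
  simp only [map_add, map_sub, map_smul, inner_add_left, inner_sub_left, inner_smul_left,
    Complex.conj_ofReal, inner_invNormMul_normSqMul_left, map_ofNat, map_natCast]
  push_cast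
  ring

lemma inner_invNormMul_raising {b : ℝ} (f : 𝓢(EuclideanSpace ℝ (Fin 3), ℂ))
    {g : 𝓢(EuclideanSpace ℝ (Fin 3), ℂ)} (hg : hermiteCLM g = (b : ℂ) • g) :
    inner ℂ (invNormMul f) (invNormMul (raising g))
      = 2 * inner ℂ (f.toLp 2 volume) (g.toLp 2 volume)
        - 2 * inner ℂ (invNormMul f) (invNormMul (eulerField g))
        - (3 + b) * inner ℂ (invNormMul f) (invNormMul g) := by
  rw [raising_eq, hg]
  simp only [map_sub, map_smul, inner_sub_right, inner_smul_right, inner_invNormMul_normSqMul]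
  push_cast
  ring

/-- The form `⟨f, |x|⁻² g⟩` intertwines the raising and lowering operators between consecutive
eigenspaces of the same parity. This is the infinitesimal form of the invariance of
`∫ ‖|x|⁻¹ e^{-itH} f‖² dt` under the metaplectic action of `SL₂(ℝ)`. -/
lemma inner_invNormMul_lowering_eq_raising {N : ℕ} {f g : 𝓢(EuclideanSpace ℝ (Fin 3), ℂ)}
    (hf : f ∈ eigenspace 3 (N + 2)) (hg : g ∈ eigenspace 3 N) :
    inner ℂ (invNormMul (lowering f)) (invNormMul g)
      = inner ℂ (invNormMul f) (invNormMul (raising g)) := by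
  rw [inner_invNormMul_lowering (hermiteCLM_of_mem hf),
    inner_invNormMul_raising _ (hermiteCLM_of_mem hg)]
  simp only [energy]
  push_cast
  linear_combination 2 * inner_invNormMul_eulerField f g

/-- On the kernel of the lowering operator (solid harmonics of degree `N` times the Gaussian) the
weighted norm is explicit. -/
lemma norm_sq_invNormMul_of_lowering_eq_zero {N : ℕ} {f : 𝓢(EuclideanSpace ℝ (Fin 3), ℂ)}
    (hf : f ∈ eigenspace 3 N) (h : lowering f = 0) :
    (2 * N + 1) * ‖invNormMul f‖ ^ 2 = 2 * ‖f.toLp 2 volume‖ ^ 2 := by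
  have h1 := inner_invNormMul_lowering (hermiteCLM_of_mem hf) f
  have h2 := congrArg (starRingEnd ℂ) h1
  have h3 := inner_invNormMul_eulerField f f
  rw [h] at h1 h2
  simp only [map_zero, inner_zero_left, map_add, map_mul, map_sub, inner_conj_symm,
    Complex.conj_ofReal, map_ofNat] at h1 h2
  have h4 : ((2 * N + 1 : ℝ) : ℂ) * inner ℂ (invNormMul f) (invNormMul f)
      = 2 * inner ℂ (f.toLp 2 volume) (f.toLp 2 volume) := by
    simp only [energy] at h1 h2
    push_cast at h1 h2 ⊢
    linear_combination (1 / 2) * h1 + (1 / 2) * h2 + h3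
  rw [inner_self_eq_ofReal_norm_sq, inner_self_eq_ofReal_norm_sq] at h4
  exact_mod_cast h4

/-- **The bound on eigenfunctions**: `∫ |f|² / |x|² ≤ 2 ∫ |f|²` for every eigenfunction, with a
constant independent of the energy. The largest eigenvalue of the form `⟨f, |x|⁻² g⟩` on the
eigenspace of degree `N` is either attained on the kernel of the lowering operator, or is an
eigenvalue on the eigenspace of degree `N - 2`. -/
theorem norm_sq_invNormMul_le {N : ℕ} {f : 𝓢(EuclideanSpace ℝ (Fin 3), ℂ)}
    (hf : f ∈ eigenspace 3 N) :
    ‖invNormMul f‖ ^ 2 ≤ 2 * ‖f.toLp 2 volume‖ ^ 2 := by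
  induction N using Nat.strong_induction_on generalizing f with
  | _ N ih =>
  set J : 𝓢(EuclideanSpace ℝ (Fin 3), ℂ) →ₗ[ℂ] L2 3 :=
    (SchwartzMap.toLpCLM ℂ ℂ 2 volume).toLinearMap
  have hJ : ∀ g, J g = g.toLp 2 volume := fun g => rfl
  have hJinj : Function.Injective J := SchwartzMap.injective_toLp 2 volume
  let e := Submodule.equivMapOfInjective J hJinj (eigenspace 3 N)
  have he : ∀ g, ((e g : (eigenspace 3 N).map J) : L2 3) = (g : 𝓢(_, ℂ)).toLp 2 volume :=
    fun g => rfl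
  let A : (eigenspace 3 N).map J →ₗ[ℂ] L2 3 :=
    invNormMul ∘ₗ (eigenspace 3 N).subtype ∘ₗ e.symm.toLinearMap
  have hA : ∀ g, A (e g) = invNormMul (g : 𝓢(_, ℂ)) := fun g => by simp [A]
  have main := norm_sq_le_of_eigenvalue_le A 2 ?_ (e ⟨f, hf⟩)
  · rw [hA] at main
    exact main
  intro v hv μ hμ
  obtain ⟨⟨g, hg⟩, rfl⟩ := e.surjective v
  have hg0 : g ≠ 0 := by
    rintro rfl
    exact hv (e.map_zero)
  have hμ' : ∀ φ ∈ eigenspace 3 N, inner ℂ (invNormMul φ) (invNormMul g)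
      = μ * inner ℂ (φ.toLp 2 volume) (g.toLp 2 volume) := by
    intro φ hφ
    have := hμ (e ⟨φ, hφ⟩)
    rwa [hA, hA] at this
  -- a weak eigenvector whose weighted norm obeys the bound has eigenvalue at most two
  have fin : ∀ φ : 𝓢(EuclideanSpace ℝ (Fin 3), ℂ), φ ≠ 0 →
      inner ℂ (invNormMul φ) (invNormMul φ)
        = μ * inner ℂ (φ.toLp 2 volume) (φ.toLp 2 volume) →
      ‖invNormMul φ‖ ^ 2 ≤ 2 * ‖φ.toLp 2 volume‖ ^ 2 → μ ≤ 2 := by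
    intro φ hφ h1 h2
    rw [inner_self_eq_ofReal_norm_sq, inner_self_eq_ofReal_norm_sq] at h1
    have h3 : ‖invNormMul φ‖ ^ 2 = μ * ‖φ.toLp 2 volume‖ ^ 2 := by exact_mod_cast h1
    have h4 : 0 < ‖φ.toLp 2 volume‖ ^ 2 := by
      have : φ.toLp 2 volume ≠ 0 := fun h0 => hφ (hJinj (by rw [hJ, h0, map_zero]))
      positivity
    rw [h3] at h2
    exact le_of_mul_le_mul_right h2 h4
  by_cases hl : lowering g = 0
  · refine fin g hg0 (hμ' g hg) ?_
    have h := norm_sq_invNormMul_of_lowering_eq_zero hg hl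
    nlinarith [sq_nonneg ‖invNormMul g‖, mul_nonneg (Nat.cast_nonneg (α := ℝ) N)
      (sq_nonneg ‖invNormMul g‖)]
  · obtain ⟨M, rfl⟩ : ∃ M, N = M + 2 := by
      refine ⟨N - 2, ?_⟩
      by_contra hN
      exact hl (lowering_eq_zero_of_mem (by omega) hg)
    have hlg := lowering_mem_eigenspace hg
    refine fin (lowering g) hl ?_ (ih M (by omega) hlg)
    rw [inner_invNormMul_lowering_eq_raising hg hlg, ← inner_conj_symm,
      hμ' _ (raising_mem_eigenspace hlg), inner_raising, map_mul, inner_conj_symm,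
      Complex.conj_ofReal]

end EigenspaceBound

/-! ### Expansion in eigenfunctions -/

section Expansion

variable {n : ℕ}

lemma integral_schwartz_mul_eq_inner (φ : 𝓢(EuclideanSpace ℝ (Fin n), ℂ)) (w : L2 n) :
    ∫ x, φ x * w x = inner ℂ ((conjSchwartz φ).toLp 2 volume) w := by
  refine integral_congr_ae ?_
  filter_upwards [(conjSchwartz φ).coeFn_toLp 2 volume] with x hx
  rw [hx, RCLike.inner_apply, conjSchwartz_apply, Complex.conj_conj, mul_comm]

lemma conjSchwartz_mem_eigenspace {N : ℕ} {f : 𝓢(EuclideanSpace ℝ (Fin n), ℂ)}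
    (hf : f ∈ eigenspace n N) : conjSchwartz f ∈ eigenspace n N := by
  induction N generalizing f with
  | zero =>
    obtain ⟨c, rfl⟩ := Submodule.mem_span_singleton.1 hf
    refine Submodule.mem_span_singleton.2 ⟨(starRingEnd ℂ) c, ?_⟩
    ext x
    simp only [smul_apply, smul_eq_mul, conjSchwartz_apply, map_mul, gaussian_apply,
      Complex.conj_ofReal]
  | succ N ih =>
    refine eigenspace_succ_induction (p := fun f => conjSchwartz f ∈ eigenspace n (N + 1))
      (fun i g hg => ?_) (by simp) (fun f g hf hg => ?_) hf
    · rw [conjSchwartz_creation]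
      exact creation_mem_eigenspace (ih hg) i
    · rw [map_add]; exact Submodule.add_mem _ hf hg

lemma inner_eq_zero_of_mem_eigenspace {N M : ℕ} (hNM : N ≠ M)
    {f g : 𝓢(EuclideanSpace ℝ (Fin n), ℂ)} (hf : f ∈ eigenspace n N) (hg : g ∈ eigenspace n M) :
    inner ℂ (f.toLp 2 volume) (g.toLp 2 volume) = 0 := by
  have h := inner_hermiteCLM f g
  rw [hermiteCLM_of_mem hf, hermiteCLM_of_mem hg] at h
  simp only [← SchwartzMap.toLpCLM_apply (𝕜 := ℂ), map_smul, inner_smul_left, inner_smul_right,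
    Complex.conj_ofReal] at h
  simp only [SchwartzMap.toLpCLM_apply] at h
  rw [← sub_eq_zero, ← sub_mul] at h
  refine (mul_eq_zero.1 h).resolve_left ?_
  rw [sub_eq_zero, Complex.ofReal_inj]
  simpa [energy] using hNM

/-- The eigenspaces, as subspaces of `L²(ℝⁿ)`. -/
noncomputable def eigenspaceL2 (n N : ℕ) : Submodule ℂ (L2 n) :=
  (eigenspace n N).map (SchwartzMap.toLpCLM ℂ ℂ 2 volume).toLinearMap

instance finiteDimensional_eigenspaceL2 (N : ℕ) : FiniteDimensional ℂ (eigenspaceL2 n N) :=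
  Module.Finite.map (eigenspace n N) (SchwartzMap.toLpCLM ℂ ℂ 2 volume).toLinearMap

lemma toLp_mem_eigenspaceL2 {N : ℕ} {f : 𝓢(EuclideanSpace ℝ (Fin n), ℂ)}
    (hf : f ∈ eigenspace n N) : f.toLp 2 volume ∈ eigenspaceL2 n N :=
  Submodule.mem_map_of_mem hf

lemma orthogonalFamily_eigenspaceL2 :
    OrthogonalFamily ℂ (fun N => eigenspaceL2 n N) fun N => (eigenspaceL2 n N).subtypeₗᵢ := by
  rintro N M hNM ⟨_, f, hf, rfl⟩ ⟨_, g, hg, rfl⟩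
  exact inner_eq_zero_of_mem_eigenspace hNM hf hg

lemma isHilbertSum_eigenspaceL2 :
    IsHilbertSum ℂ (fun N => eigenspaceL2 n N) fun N => (eigenspaceL2 n N).subtypeₗᵢ := by
  have (N : ℕ) : CompleteSpace (eigenspaceL2 n N) := FiniteDimensional.complete ℂ _
  refine IsHilbertSum.mkInternal _ orthogonalFamily_eigenspaceL2 ?_
  rw [top_le_iff, Submodule.topologicalClosure_eq_top_iff, Submodule.eq_bot_iff]
  intro w hw
  refine eq_zero_of_integral_eigenspace_mul_eq_zero w fun N f hf => ?_
  rw [integral_schwartz_mul_eq_inner]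
  exact (Submodule.mem_orthogonal _ _).1 hw _
    (Submodule.mem_iSup_of_mem N (toLp_mem_eigenspaceL2 (conjSchwartz_mem_eigenspace hf)))

/-- Every `d ∈ L²(ℝⁿ)` is an orthogonal sum of eigenfunctions. -/
lemma exists_hasSum_eigenfunctions (d : L2 n) :
    ∃ c : ℕ → 𝓢(EuclideanSpace ℝ (Fin n), ℂ), (∀ N, c N ∈ eigenspace n N) ∧
      HasSum (fun N => (c N).toLp 2 volume) d := by
  have h := isHilbertSum_eigenspaceL2 (n := n)
  have hs := h.hasSum_linearIsometryEquiv_symm (h.linearIsometryEquiv d)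
  rw [LinearIsometryEquiv.symm_apply_apply] at hs
  choose c hc hcd using fun N => (h.linearIsometryEquiv d N).2
  refine ⟨c, hc, ?_⟩
  convert hs using 2 with N
  exact hcd N

lemma hasSum_norm_sq_of_hasSum {c : ℕ → 𝓢(EuclideanSpace ℝ (Fin n), ℂ)}
    (hc : ∀ N, c N ∈ eigenspace n N) {d : L2 n} (h : HasSum (fun N => (c N).toLp 2 volume) d) :
    HasSum (fun N => ‖(c N).toLp 2 volume‖ ^ 2) (‖d‖ ^ 2) := by
  have h1 : HasSum (fun N => inner ℂ d ((c N).toLp 2 volume)) (inner ℂ d d) :=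
    h.mapL (innerSL ℂ d)
  have h2 : ∀ N, inner ℂ d ((c N).toLp 2 volume)
      = ((‖(c N).toLp 2 volume‖ ^ 2 : ℝ) : ℂ) := by
    intro N
    have h3 : HasSum (fun M => inner ℂ ((c N).toLp 2 volume) ((c M).toLp 2 volume))
        (inner ℂ ((c N).toLp 2 volume) d) := h.mapL (innerSL ℂ ((c N).toLp 2 volume))
    -- only the term of degree `N` survives
    have h4 := h3.unique (hasSum_single N fun M hM =>
      inner_eq_zero_of_mem_eigenspace hM.symm (hc N) (hc M))
    rw [← inner_conj_symm, h4, inner_self_eq_ofReal_norm_sq, Complex.conj_ofReal]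
  simp only [h2, inner_self_eq_ofReal_norm_sq] at h1
  exact Complex.hasSum_ofReal.1 h1

lemma summable_of_summable_norm_sq {c : ℕ → 𝓢(EuclideanSpace ℝ (Fin n), ℂ)}
    (hc : ∀ N, c N ∈ eigenspace n N) (h : Summable fun N => ‖(c N).toLp 2 volume‖ ^ 2) :
    Summable fun N => (c N).toLp 2 volume :=
  (orthogonalFamily_eigenspaceL2.summable_iff_norm_sq_summable
    (fun N => (⟨_, toLp_mem_eigenspaceL2 (hc N)⟩ : eigenspaceL2 n N))).2 h

end Expansion

/-! ### Existence and uniqueness of the evolution -/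

section Evolution

variable {n : ℕ}

/-- The phase `e^{-itλ}` of the eigenfunctions of degree `N` at time `t`. -/
noncomputable def phase (n N : ℕ) (t : ℝ) : ℂ := Complex.exp (-Complex.I * energy n N * t)

@[simp]
lemma norm_phase (N : ℕ) (t : ℝ) : ‖phase n N t‖ = 1 := by
  rw [phase, show -Complex.I * energy n N * t = ((-(energy n N * t) : ℝ) : ℂ) * Complex.I by
    push_cast; ring]
  exact Complex.norm_exp_ofReal_mul_I _

lemma phase_zero (N : ℕ) : phase n N 0 = 1 := by simp [phase]

lemma continuous_phase (N : ℕ) : Continuous (phase n N) := by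
  unfold phase
  fun_prop

lemma hasDerivAt_phase (N : ℕ) (t : ℝ) :
    HasDerivAt (phase n N) (-Complex.I * energy n N * phase n N t) t := by
  have h := ((Complex.ofRealCLM.hasDerivAt (x := t)).const_mul
    (-Complex.I * energy n N : ℂ)).cexp
  refine h.congr_deriv ?_
  simp [phase, mul_comm]

/-- The evolution `∑ₙ e^{-itλₙ} cₙ` of a series of eigenfunctions. -/
noncomputable def evolution (c : ℕ → 𝓢(EuclideanSpace ℝ (Fin n), ℂ)) (t : ℝ) : L2 n :=
  ∑' N, phase n N t • (c N).toLp 2 volume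

variable {c : ℕ → 𝓢(EuclideanSpace ℝ (Fin n), ℂ)} {d : L2 n}

lemma hasSum_evolution (hc : ∀ N, c N ∈ eigenspace n N)
    (h : HasSum (fun N => (c N).toLp 2 volume) d) (t : ℝ) :
    HasSum (fun N => phase n N t • (c N).toLp 2 volume) (evolution c t) := by
  have h1 : ∀ N, (phase n N t • c N).toLp 2 volume = phase n N t • (c N).toLp 2 volume :=
    fun N => (SchwartzMap.toLpCLM ℂ ℂ 2 volume).map_smul _ _
  have h2 := summable_of_summable_norm_sq (c := fun N => phase n N t • c N)
    (fun N => Submodule.smul_mem _ _ (hc N))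
    (by simpa [h1, norm_smul] using (hasSum_norm_sq_of_hasSum hc h).summable)
  simp only [h1] at h2
  exact h2.hasSum

lemma norm_evolution (hc : ∀ N, c N ∈ eigenspace n N)
    (h : HasSum (fun N => (c N).toLp 2 volume) d) (t : ℝ) : ‖evolution c t‖ = ‖d‖ := by
  have h1 : ∀ N, (phase n N t • c N).toLp 2 volume = phase n N t • (c N).toLp 2 volume :=
    fun N => (SchwartzMap.toLpCLM ℂ ℂ 2 volume).map_smul _ _
  have h2 := hasSum_evolution hc h t
  simp only [← h1] at h2
  have h3 := hasSum_norm_sq_of_hasSum (fun N => Submodule.smul_mem _ _ (hc N)) h2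
  simp only [h1, norm_smul, norm_phase, one_mul] at h3
  have h4 := h3.unique (hasSum_norm_sq_of_hasSum hc h)
  exact (sq_eq_sq₀ (norm_nonneg _) (norm_nonneg _)).1 h4

/-- Strong continuity of the evolution follows from weak continuity, since the norm is
conserved. -/
lemma continuous_evolution (hc : ∀ N, c N ∈ eigenspace n N)
    (h : HasSum (fun N => (c N).toLp 2 volume) d) : Continuous (evolution c) := by
  have hweak : ∀ w : L2 n, Continuous fun t => inner ℂ w (evolution c t) := by
    intro w
    have h1 : ∀ t, inner ℂ w (evolution c t)
        = ∑' N, phase n N t * inner ℂ w ((c N).toLp 2 volume) := by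
      intro t
      have := (hasSum_evolution hc h t).mapL (innerSL ℂ w)
      simpa [inner_smul_right] using this.tsum_eq.symm
    simp_rw [h1]
    have h2 : Summable fun N => ‖inner ℂ w ((c N).toLp 2 volume)‖ :=
      (h.mapL (innerSL ℂ w)).summable.norm
    refine continuous_tsum (fun N => (continuous_phase N).mul continuous_const) h2
      fun N t => ?_
    simp
  rw [continuous_iff_continuousAt]
  intro s
  rw [ContinuousAt, tendsto_iff_norm_sub_tendsto_zero]
  have hsq : Tendsto (fun t => ‖evolution c t - evolution c s‖ ^ 2) (𝓝 s) (𝓝 0) := by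
    have e : ∀ t, ‖evolution c t - evolution c s‖ ^ 2
        = 2 * ‖d‖ ^ 2 - 2 * (inner ℂ (evolution c s) (evolution c t)).re := by
      intro t
      rw [@norm_sub_sq ℂ, norm_evolution hc h, norm_evolution hc h, ← inner_conj_symm,
        RCLike.conj_re]
      change _ - 2 * (inner ℂ (evolution c s) (evolution c t)).re + _ = _
      ring
    simp_rw [e]
    have h1 := (Complex.continuous_re.comp (hweak (evolution c s))).tendsto s
    have h2 := (h1.const_mul 2).const_sub (2 * ‖d‖ ^ 2)
    rw [Function.comp_apply, inner_self_eq_ofReal_norm_sq, norm_evolution hc h, Complex.ofReal_re,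
      sub_self] at h2
    exact h2
  have := hsq.sqrt
  simpa using this

theorem isSolution_evolution (hc : ∀ N, c N ∈ eigenspace n N)
    (h : HasSum (fun N => (c N).toLp 2 volume) d) : IsSolution d (evolution c) where
  continuous := continuous_evolution hc h
  initial := by
    have := hasSum_evolution hc h 0
    simp only [phase_zero, one_smul] at this
    exact this.unique h
  equation := by
    intro φ t
    have hpair : ∀ (ψ : 𝓢(EuclideanSpace ℝ (Fin n), ℂ)) (s : ℝ),
        HasSum (fun N => phase n N s * ∫ x, ψ x * (c N).toLp 2 volume x)
          (∫ x, ψ x * evolution c s x) := by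
      intro ψ s
      simp only [integral_schwartz_mul_eq_inner]
      have := (hasSum_evolution hc h s).mapL (innerSL ℂ ((conjSchwartz ψ).toLp 2 volume))
      simpa [inner_smul_right] using this
    -- moving `H` onto the test function makes the series of time derivatives absolutely summable
    have hsummable : Summable fun N => ‖∫ x, hermiteCLM φ x * (c N).toLp 2 volume x‖ := by
      simp only [integral_schwartz_mul_eq_inner]
      exact (h.mapL (innerSL ℂ ((conjSchwartz (hermiteCLM φ)).toLp 2 volume))).summable.norm
    have heigen : ∀ N, ∫ x, hermiteCLM φ x * (c N).toLp 2 volume x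
        = energy n N * ∫ x, φ x * (c N).toLp 2 volume x := by
      intro N
      have h1 : ∀ ψ : 𝓢(EuclideanSpace ℝ (Fin n), ℂ), ∫ x, ψ x * (c N).toLp 2 volume x
          = ∫ x, ψ x * c N x := by
        intro ψ
        refine integral_congr_ae ?_
        filter_upwards [(c N).coeFn_toLp 2 volume] with x hx
        rw [hx]
      rw [h1, h1, integral_hermiteCLM_mul, hermiteCLM_of_mem (hc N), ← integral_const_mul]
      refine integral_congr_ae (Eventually.of_forall fun x => ?_)
      simp only [smul_apply, smul_eq_mul]
      ring
    have hderiv := hasDerivAt_tsum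
      (g := fun N s => phase n N s * ∫ x, φ x * (c N).toLp 2 volume x)
      (g' := fun N s => -Complex.I * (phase n N s * ∫ x, hermiteCLM φ x * (c N).toLp 2 volume x))
      hsummable (fun N s => ?_) (fun N s => ?_) (hpair φ 0).summable t
    · simp only [fun s => (hpair φ s).tsum_eq] at hderiv
      rw [tsum_mul_left, (hpair (hermiteCLM φ) t).tsum_eq, hermiteCLM_apply] at hderiv
      exact hderiv
    · rw [heigen]
      refine ((hasDerivAt_phase N s).mul_const _).congr_deriv ?_
      ring
    · simp

/-- Pairing a solution with an eigenfunction gives a scalar linear ODE. -/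
lemma IsSolution.integral_eigenfunction_mul {u : ℝ → L2 n} (hu : IsSolution d u) {N : ℕ}
    {f : 𝓢(EuclideanSpace ℝ (Fin n), ℂ)} (hf : f ∈ eigenspace n N) (t : ℝ) :
    ∫ x, f x * u t x = phase n N t * ∫ x, f x * d x := by
  set y : ℝ → ℂ := fun s => ∫ x, f x * u s x with hy
  have hy' : ∀ s, HasDerivAt y (-Complex.I * energy n N * y s) s := by
    intro s
    refine (hu.equation f s).congr_deriv ?_
    rw [← hermiteCLM_apply, hermiteCLM_of_mem hf]
    simp only [smul_apply, smul_eq_mul, mul_assoc, integral_const_mul, hy]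
  have hp0 : ∀ s, phase n N s ≠ 0 := fun s => Complex.exp_ne_zero _
  have hconst : ∀ s, HasDerivAt (fun s => y s / phase n N s) 0 s := by
    intro s
    refine ((hy' s).div (hasDerivAt_phase N s) (hp0 s)).congr_deriv ?_
    have := hp0 s
    field_simp
    ring
  have h := is_const_of_deriv_eq_zero (f := fun s => y s / phase n N s)
    (fun s => (hconst s).differentiableAt)
    (fun s => (hconst s).deriv) t 0
  simp only [phase_zero, div_one] at h
  rw [div_eq_iff (hp0 t), mul_comm] at h
  simp only [hy, hu.initial] at h
  exact h

theorem IsSolution.unique {u v : ℝ → L2 n} (hu : IsSolution d u) (hv : IsSolution d v) :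
    u = v := by
  funext t
  rw [← sub_eq_zero]
  refine eq_zero_of_integral_eigenspace_mul_eq_zero _ fun N f hf => ?_
  have h1 := hu.integral_eigenfunction_mul hf t
  have h2 := hv.integral_eigenfunction_mul hf t
  rw [integral_schwartz_mul_eq_inner] at h1 h2 ⊢
  rw [inner_sub_right, h1, h2, sub_self]

end Evolution

/-! ### The space-time estimate -/

section Parseval

lemma integral_exp_int_mul {k : ℤ} (hk : k ≠ 0) :
    ∫ t in (0 : ℝ)..(2 * Real.pi), Complex.exp (k * Complex.I * t) = 0 := by
  have hk' : (k : ℂ) * Complex.I ≠ 0 := mul_ne_zero (by exact_mod_cast hk) Complex.I_ne_zero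
  rw [integral_exp_mul_complex hk']
  have : Complex.exp ((k : ℂ) * Complex.I * ((2 * Real.pi : ℝ) : ℂ)) = 1 := by
    rw [← Complex.exp_int_mul_two_pi_mul_I k]
    congr 1
    push_cast
    ring
  rw [this]
  simp

/-- Parseval's identity over one period: the energies differ by integers. -/
lemma integral_norm_sq_sum_phase {H : Type*} [NormedAddCommGroup H] [InnerProductSpace ℂ H]
    (n : ℕ) (v : ℕ → H) (s : Finset ℕ) :
    ∫ t in (0 : ℝ)..(2 * Real.pi), ‖∑ N ∈ s, phase n N t • v N‖ ^ 2
      = 2 * Real.pi * ∑ N ∈ s, ‖v N‖ ^ 2 := by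
  have hphase : ∀ N M t, (starRingEnd ℂ) (phase n N t) * phase n M t
      = Complex.exp (((2 * (N : ℤ) - 2 * M : ℤ) : ℂ) * Complex.I * t) := by
    intro N M t
    simp only [phase, ← Complex.exp_conj, ← Complex.exp_add, energy]
    congr 1
    simp [map_ofNat (starRingEnd ℂ) 2]
    ring
  have e : ∀ t, ((‖∑ N ∈ s, phase n N t • v N‖ ^ 2 : ℝ) : ℂ)
      = ∑ N ∈ s, ∑ M ∈ s, Complex.exp (((2 * (N : ℤ) - 2 * M : ℤ) : ℂ) * Complex.I * t)
        * inner ℂ (v N) (v M) := by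
    intro t
    rw [← inner_self_eq_ofReal_norm_sq, sum_inner]
    refine Finset.sum_congr rfl fun N _ => ?_
    rw [inner_sum]
    refine Finset.sum_congr rfl fun M _ => ?_
    rw [inner_smul_left, inner_smul_right, ← mul_assoc, hphase]
  have hcont : ∀ N M : ℕ, IntervalIntegrable (fun t : ℝ =>
      Complex.exp (((2 * (N : ℤ) - 2 * M : ℤ) : ℂ) * Complex.I * t) * inner ℂ (v N) (v M))
      volume 0 (2 * Real.pi) := fun N M => Continuous.intervalIntegrable (by fun_prop) _ _
  have hint : ∀ N M : ℕ, ∫ t in (0 : ℝ)..(2 * Real.pi),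
      Complex.exp (((2 * (N : ℤ) - 2 * M : ℤ) : ℂ) * Complex.I * t) * inner ℂ (v N) (v M)
      = if N = M then ((2 * Real.pi * ‖v N‖ ^ 2 : ℝ) : ℂ) else 0 := by
    intro N M
    rw [intervalIntegral.integral_mul_const]
    split_ifs with hNM
    · subst hNM
      rw [inner_self_eq_ofReal_norm_sq]
      simp
    · rw [integral_exp_int_mul (by omega), zero_mul]
  rw [← Complex.ofReal_inj, ← intervalIntegral.integral_ofReal]
  simp_rw [e]
  rw [intervalIntegral.integral_finsetSum]
  · simp_rw [intervalIntegral.integral_finsetSum fun M _ => hcont _ M, hint]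
    simp [Finset.mul_sum]
  · exact fun N _ => Continuous.intervalIntegrable (by fun_prop) _ _

end Parseval

section Truncation

/-- The weight `|x|⁻¹`, truncated at height `k`. -/
noncomputable def truncWeight (k : ℕ) (x : EuclideanSpace ℝ (Fin 3)) : ℝ := min ‖x‖⁻¹ k

lemma truncWeight_nonneg (k : ℕ) (x : EuclideanSpace ℝ (Fin 3)) : 0 ≤ truncWeight k x :=
  le_min (by positivity) (by positivity)

lemma truncWeight_le_inv (k : ℕ) (x : EuclideanSpace ℝ (Fin 3)) : truncWeight k x ≤ ‖x‖⁻¹ :=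
  min_le_left _ _

lemma truncWeight_le (k : ℕ) (x : EuclideanSpace ℝ (Fin 3)) : truncWeight k x ≤ k :=
  min_le_right _ _

lemma monotone_truncWeight (x : EuclideanSpace ℝ (Fin 3)) : Monotone fun k => truncWeight k x :=
  fun _ _ h => min_le_min le_rfl (Nat.cast_le.2 h)

lemma measurable_truncWeight (k : ℕ) : Measurable (truncWeight k) := by
  unfold truncWeight
  fun_prop

lemma memLp_truncWeight_mul (k : ℕ) (v : L2 3) :
    MemLp (fun x => (truncWeight k x : ℂ) * v x) 2 volume := by
  refine (Lp.memLp v).of_le_mul (c := k) ?_ (Eventually.of_forall fun x => ?_)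
  · have := measurable_truncWeight k
    exact (Measurable.aestronglyMeasurable (by fun_prop)).mul (Lp.aestronglyMeasurable v)
  · rw [norm_mul, Complex.norm_real, Real.norm_of_nonneg (truncWeight_nonneg k x)]
    gcongr
    exact truncWeight_le k x

/-- Multiplication by the truncated weight, as a bounded operator on `L²(ℝ³)`. -/
noncomputable def truncMul (k : ℕ) : L2 3 →L[ℂ] L2 3 :=
  LinearMap.mkContinuous
    { toFun := fun v => (memLp_truncWeight_mul k v).toLp _
      map_add' := fun v w => by
        rw [← MemLp.toLp_add]
        refine MemLp.toLp_congr _ _ ?_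
        filter_upwards [Lp.coeFn_add v w] with x hx
        simp only [hx, Pi.add_apply, mul_add]
      map_smul' := fun a v => by
        rw [RingHom.id_apply, ← MemLp.toLp_const_smul]
        refine MemLp.toLp_congr _ _ ?_
        filter_upwards [Lp.coeFn_smul a v] with x hx
        simp [hx]
        ring }
    k fun v => by
      refine Lp.norm_le_mul_norm_of_ae_le_mul ?_
      filter_upwards [(memLp_truncWeight_mul k v).coeFn_toLp] with x hx
      change ‖(memLp_truncWeight_mul k v).toLp _ x‖ ≤ _
      rw [hx, norm_mul, Complex.norm_real, Real.norm_of_nonneg (truncWeight_nonneg k x)]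
      gcongr
      exact truncWeight_le k x

lemma coeFn_truncMul (k : ℕ) (v : L2 3) :
    truncMul k v =ᵐ[volume] fun x => (truncWeight k x : ℂ) * v x :=
  (memLp_truncWeight_mul k v).coeFn_toLp

lemma norm_truncMul_toLp_le (k : ℕ) (f : 𝓢(EuclideanSpace ℝ (Fin 3), ℂ)) :
    ‖truncMul k (f.toLp 2 volume)‖ ≤ ‖invNormMul f‖ := by
  refine Lp.norm_le_norm_of_ae_le ?_
  filter_upwards [coeFn_truncMul k (f.toLp 2 volume), f.coeFn_toLp 2 volume,
    coeFn_invNormMul f] with x h1 h2 h3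
  rw [h1, h2, h3, norm_mul, norm_mul, Complex.norm_real, Complex.norm_real,
    Real.norm_of_nonneg (truncWeight_nonneg k x), Real.norm_of_nonneg (by positivity)]
  gcongr
  exact truncWeight_le_inv k x

lemma ofReal_norm_sq_truncMul (k : ℕ) (v : L2 3) :
    ENNReal.ofReal (‖truncMul k v‖ ^ 2)
      = ∫⁻ x, ENNReal.ofReal (truncWeight k x ^ 2 * ‖v x‖ ^ 2) := by
  have h1 : ‖truncMul k v‖ ^ 2 = ∫ x, ‖truncMul k v x‖ ^ 2 := by
    have h2 : inner ℂ (truncMul k v) (truncMul k v)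
        = ∫ x, ((‖truncMul k v x‖ ^ 2 : ℝ) : ℂ) :=
      integral_congr_ae (Eventually.of_forall fun x => inner_self_eq_ofReal_norm_sq _)
    rw [inner_self_eq_ofReal_norm_sq, integral_complex_ofReal] at h2
    exact_mod_cast h2
  rw [h1, ofReal_integral_eq_lintegral_ofReal]
  · refine lintegral_congr_ae ?_
    filter_upwards [coeFn_truncMul k v] with x hx
    rw [hx, norm_mul, Complex.norm_real, Real.norm_of_nonneg (truncWeight_nonneg k x), mul_pow]
  · exact (memLp_two_iff_integrable_sq_norm (Lp.aestronglyMeasurable _)).1 (Lp.memLp _)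
  · exact Eventually.of_forall fun x => by positivity

lemma iSup_ofReal_norm_sq_truncMul (v : L2 3) :
    ⨆ k, ENNReal.ofReal (‖truncMul k v‖ ^ 2)
      = ∫⁻ x, ENNReal.ofReal (‖v x‖ ^ 2 / ‖x‖ ^ 2) := by
  simp_rw [ofReal_norm_sq_truncMul]
  rw [← lintegral_iSup']
  · refine lintegral_congr fun x => le_antisymm (iSup_le fun k => ?_) ?_
    · refine ENNReal.ofReal_le_ofReal ?_
      rw [div_eq_inv_mul, ← inv_pow]
      have := truncWeight_nonneg k x
      gcongr
      exact truncWeight_le_inv k x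
    · obtain ⟨k, hk⟩ := exists_nat_ge ‖x‖⁻¹
      refine le_iSup_of_le k (ENNReal.ofReal_le_ofReal ?_)
      rw [truncWeight, min_eq_left hk, div_eq_inv_mul, inv_pow]
  · intro k
    have h1 : AEMeasurable (fun x => ‖v x‖) := (Lp.aestronglyMeasurable v).norm.aemeasurable
    have h2 := (measurable_truncWeight k).aemeasurable (μ := volume)
    exact ((h2.pow_const 2).mul (h1.pow_const 2)).ennreal_ofReal
  · refine Eventually.of_forall fun x i j hij => ENNReal.ofReal_le_ofReal ?_
    have := truncWeight_nonneg i x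
    gcongr
    exact monotone_truncWeight x hij

variable {c : ℕ → 𝓢(EuclideanSpace ℝ (Fin 3), ℂ)} {d : L2 3}

/-- The estimate for a finite sum of eigenfunctions, by Parseval in time and the bound on each
eigenspace. -/
lemma lintegral_norm_sq_truncMul_sum_le (hc : ∀ N, c N ∈ eigenspace 3 N)
    (h : HasSum (fun N => (c N).toLp 2 volume) d) (k : ℕ) (s : Finset ℕ) :
    ∫⁻ t in Set.Icc (0 : ℝ) (2 * Real.pi),
        ENNReal.ofReal (‖truncMul k (∑ N ∈ s, phase 3 N t • (c N).toLp 2 volume)‖ ^ 2)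
      ≤ ENNReal.ofReal (4 * Real.pi * ‖d‖ ^ 2) := by
  have hcont : Continuous fun t =>
      ‖truncMul k (∑ N ∈ s, phase 3 N t • (c N).toLp 2 volume)‖ ^ 2 := by
    have h1 : Continuous fun t => ∑ N ∈ s, phase 3 N t • (c N).toLp 2 volume :=
      continuous_finsetSum _ fun N _ => (continuous_phase N).smul continuous_const
    exact ((truncMul k).continuous.comp h1).norm.pow 2
  rw [← ofReal_integral_eq_lintegral_ofReal hcont.integrableOn_Icc
    (Eventually.of_forall fun t => by positivity)]
  refine ENNReal.ofReal_le_ofReal ?_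
  rw [integral_Icc_eq_integral_Ioc, ← intervalIntegral.integral_of_le (by positivity)]
  simp only [map_sum, map_smul]
  rw [integral_norm_sq_sum_phase]
  have h2 : ∑ N ∈ s, ‖truncMul k ((c N).toLp 2 volume)‖ ^ 2 ≤ 2 * ‖d‖ ^ 2 := by
    calc _ ≤ ∑ N ∈ s, 2 * ‖(c N).toLp 2 volume‖ ^ 2 := by
          refine Finset.sum_le_sum fun N _ => ?_
          refine le_trans ?_ (norm_sq_invNormMul_le (hc N))
          gcongr
          exact norm_truncMul_toLp_le k (c N)
      _ ≤ 2 * ‖d‖ ^ 2 := by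
          rw [← Finset.mul_sum]
          gcongr
          exact sum_le_hasSum s (fun _ _ => by positivity) (hasSum_norm_sq_of_hasSum hc h)
  calc _ ≤ 2 * Real.pi * (2 * ‖d‖ ^ 2) := by gcongr
    _ = _ := by ring

theorem lintegral_evolution_le (hc : ∀ N, c N ∈ eigenspace 3 N)
    (h : HasSum (fun N => (c N).toLp 2 volume) d) :
    ∫⁻ t in Set.Icc (0 : ℝ) (2 * Real.pi), ∫⁻ x,
        ENNReal.ofReal (‖evolution c t x‖ ^ 2 / ‖x‖ ^ 2)
      ≤ ENNReal.ofReal (4 * Real.pi * ‖d‖ ^ 2) := by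
  have hmeas : ∀ k, Measurable fun t => ENNReal.ofReal (‖truncMul k (evolution c t)‖ ^ 2) :=
    fun k => (((truncMul k).continuous.comp (continuous_evolution hc h)).norm.pow
      2).measurable.ennreal_ofReal
  simp_rw [← iSup_ofReal_norm_sq_truncMul]
  rw [lintegral_iSup hmeas]
  · refine iSup_le fun k => ?_
    have hlim : ∀ t, Tendsto (fun M => ENNReal.ofReal
        (‖truncMul k (∑ N ∈ Finset.range M, phase 3 N t • (c N).toLp 2 volume)‖ ^ 2)) atTop
        (𝓝 (ENNReal.ofReal (‖truncMul k (evolution c t)‖ ^ 2))) := fun t =>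
      ENNReal.tendsto_ofReal (((((truncMul k).continuous.tendsto _).comp
        (hasSum_evolution hc h t).tendsto_sum_nat).norm).pow 2)
    calc _ = ∫⁻ t in Set.Icc (0 : ℝ) (2 * Real.pi), liminf (fun M => ENNReal.ofReal
          (‖truncMul k (∑ N ∈ Finset.range M, phase 3 N t • (c N).toLp 2 volume)‖ ^ 2)) atTop := by
          simp_rw [fun t => (hlim t).liminf_eq]
      _ ≤ liminf (fun M => ∫⁻ t in Set.Icc (0 : ℝ) (2 * Real.pi), ENNReal.ofReal
          (‖truncMul k (∑ N ∈ Finset.range M, phase 3 N t • (c N).toLp 2 volume)‖ ^ 2)) atTop := by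
          refine lintegral_liminf_le fun M => ?_
          have h1 : Continuous fun t => ∑ N ∈ Finset.range M, phase 3 N t • (c N).toLp 2 volume :=
            continuous_finsetSum _ fun N _ => (continuous_phase N).smul continuous_const
          exact (((truncMul k).continuous.comp h1).norm.pow 2).measurable.ennreal_ofReal
      _ ≤ _ := by
          refine liminf_le_of_le (by isBoundedDefault) fun b hb => ?_
          obtain ⟨M, hM⟩ := hb.exists
          exact hM.trans (lintegral_norm_sq_truncMul_sum_le hc h k _)
  · intro i j hij t
    simp only [ofReal_norm_sq_truncMul]
    refine lintegral_mono fun x => ENNReal.ofReal_le_ofReal ?_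
    have := truncWeight_nonneg i x
    gcongr
    exact monotone_truncWeight x hij

end Truncation

end HarmonicOscillator

theorem mainTheorem4 :
    ∃ C : ℝ, 0 < C ∧
      ∀ d : HarmonicOscillator.L2 3, HarmonicOscillator.IsEvenInEachCoordinate d →
        (∃! u : ℝ → HarmonicOscillator.L2 3, HarmonicOscillator.IsSolution d u) ∧
        ∀ u : ℝ → HarmonicOscillator.L2 3, HarmonicOscillator.IsSolution d u →
          ∫⁻ t in Set.Icc (0 : ℝ) (2 * Real.pi), ∫⁻ x : EuclideanSpace ℝ (Fin 3),
              ENNReal.ofReal (‖u t x‖ ^ 2 / ‖x‖ ^ 2)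
            ≤ ENNReal.ofReal (C * ‖d‖ ^ 2) := by
  refine ⟨4 * Real.pi, by positivity, fun d _ => ?_⟩
  obtain ⟨c, hc, hd⟩ := HarmonicOscillator.exists_hasSum_eigenfunctions d
  have hsol := HarmonicOscillator.isSolution_evolution hc hd
  refine ⟨⟨_, hsol, fun v hv => hv.unique hsol⟩, fun u hu => ?_⟩
  rw [hu.unique hsol]
  exact HarmonicOscillator.lintegral_evolution_le hc hd
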